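/- Let $\mathcal{X},\mathcal{Y}$ be finite alphabets, let $p_{XY}$ be a probability mass function on $\mathcal{X}\times\mathcal{Y}$, and let $(X_1,Y_1),(X_2,Y_2),\ldots$ be i.i.d. with law $p_{XY}$. For $R=(R_0,\ldots,R_4)\in\mathbb{R}^5$, a code of block length $n$ with rates $R$ for the extended Gray--Wyner system consists of an encoder mapping $(X^n,Y^n)$ to five indices $M_k\in[1,2^{nR_k}]\cap\mathbb{Z}$, $k=0,\ldots,4$, and four decoders: decoder 1 estimates $X^n$ from $(M_0,M_1)$; decoder 2 estimates $Y^n$ from $(M_0,M_2)$; for each time $i\in\{1,\ldots,n\}$, decoder 3 estimates $X_i$ from $(M_0,M_3,Y_1,\ldots,Y_i)$ and decoder 4 estimates $Y_i$ from $(M_0,M_4,X_1,\ldots,X_i)$. The tuple $R$ is achievable if there is a sequence of such codes, one for each block length $n$, for which the probability that at least one of the four decoders fails to reproduce its whole source sequence tends to $0$ as $n\to\infty$. The rate region $\mathscr{R}\subseteq\mathbb{R}^5$ is the closure of the set of achievable tuples. Theorem. $\mathscr{R}$ is the set of all $(R_0,R_1,R_2,R_3,R_4)\in\mathbb{R}^5$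 such that $$R_0\ge I(X,Y;U),\quad R_1\ge H(X|U),\quad R_2\ge H(Y|U),\quad R_3\ge H(X|Y,U),\quad R_4\ge H(Y|X,U)$$ for some finite set $\mathcal{U}$ with $|\mathcal{U}|\le|\mathcal{X}|\cdot|\mathcal{Y}|+2$ and some conditional probability mass function $p_{U|XY}$ on $\mathcal{U}$, where $(X,Y,U)\sim p_{XY}\,p_{U|XY}$ and entropies and mutual information are in bits. -/

import Mathlib

open Filter Topology

noncomputable section

namespace EGW

/-! ### Finite probability and information measures (in bits) -/

section Information

variable {Ω S T : Type*} [Fintype Ω] [Fintype S] [Fintype T]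

/-- Probability of the event `E` under the probability mass function `q`. -/
def prob (q : Ω → ℝ) (E : Set Ω) : ℝ := ∑ ω, E.indicator q ω

/-- The probability mass function of the random variable `f` under `q`. -/
def law {Ω S : Type*} [Fintype Ω] (q : Ω → ℝ) (f : Ω → S) (s : S) : ℝ :=
  prob q {ω | f ω = s}

/-- Conditional entropy `H(f | g) = - ∑ p(s,t) log₂ p(s|t)`, with `p(s|t) = p(s,t) / p(t)`.
Terms with `p(s,t) = 0` vanish. -/
def condEntropy (q : Ω → ℝ) (f : Ω → S) (g : Ω → T) : ℝ :=
  - ∑ s, ∑ t, law q (fun ω => (f ω, g ω)) (s, t) *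
      Real.logb 2 (law q (fun ω => (f ω, g ω)) (s, t) / law q g t)

/-- Mutual information `I(f ; g) = ∑ p(s,t) log₂ (p(s,t) / (p(s) p(t)))`.
Terms with `p(s,t) = 0` vanish. -/
def mutualInfo (q : Ω → ℝ) (f : Ω → S) (g : Ω → T) : ℝ :=
  ∑ s, ∑ t, law q (fun ω => (f ω, g ω)) (s, t) *
      Real.logb 2 (law q (fun ω => (f ω, g ω)) (s, t) / (law q f s * law q g t))

end Information

/-! ### The coding problem -/

section Coding

variable (α β : Type*)

/-- Number of elements of the message set `[1 : 2 ^ (n r)] = [1, 2 ^ (n r)] ∩ ℤ`. -/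
def numMessages (n : ℕ) (r : ℝ) : ℕ := ⌊(2 : ℝ) ^ ((n : ℝ) * r)⌋₊

/-- A code of block length `n` with rates `R 0, …, R 4`. The encoder maps the pair of source
sequences to five indices. Decoders 1 and 2 see `(M₀, M₁)` and `(M₀, M₂)`. The estimate of
decoder 3 (resp. 4) at time `i` depends on `(M₀, M₃)` (resp. `(M₀, M₄)`) and on the side
information at times `j ≤ i` only. -/
structure Code (n : ℕ) (R : Fin 5 → ℝ) where
  enc : (Fin n → α) → (Fin n → β) → (k : Fin 5) → Fin (numMessages n (R k))
  dec₁ : Fin (numMessages n (R 0)) → Fin (numMessages n (R 1)) → Fin n → α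
  dec₂ : Fin (numMessages n (R 0)) → Fin (numMessages n (R 2)) → Fin n → β
  dec₃ : (i : Fin n) → Fin (numMessages n (R 0)) → Fin (numMessages n (R 3)) →
    (Set.Iic i → β) → α
  dec₄ : (i : Fin n) → Fin (numMessages n (R 0)) → Fin (numMessages n (R 4)) →
    (Set.Iic i → α) → β

variable {α β}

/-- All four decoders reproduce their whole source sequence from the source pair `(x, y)`. -/
def Code.Correct {n : ℕ} {R : Fin 5 → ℝ} (c : Code α β n R)
    (x : Fin n → α) (y : Fin n → β) : Prop :=
  c.dec₁ (c.enc x y 0) (c.enc x y 1) = x ∧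
  c.dec₂ (c.enc x y 0) (c.enc x y 2) = y ∧
  (∀ i, c.dec₃ i (c.enc x y 0) (c.enc x y 3) (fun j => y j) = x i) ∧
  (∀ i, c.dec₄ i (c.enc x y 0) (c.enc x y 4) (fun j => x j) = y i)

variable [Fintype α] [Fintype β]

/-- Probability that some decoder errs, for `n` i.i.d. pairs drawn from `p`. -/
def errorProb (p : α × β → ℝ) {n : ℕ} {R : Fin 5 → ℝ} (c : Code α β n R) : ℝ :=
  prob (fun z : Fin n → α × β => ∏ i, p (z i))
    {z | ¬ c.Correct (fun i => (z i).1) (fun i => (z i).2)}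

/-- Some sequence of codes with rates `R` has vanishing probability of error. -/
def Achievable (p : α × β → ℝ) (R : Fin 5 → ℝ) : Prop :=
  ∃ c : (n : ℕ) → Code α β n R, Tendsto (fun n => errorProb p (c n)) atTop (𝓝 0)

/-- The rate region: closure of the set of achievable rate tuples. -/
def rateRegion (p : α × β → ℝ) : Set (Fin 5 → ℝ) :=
  closure {R | Achievable p R}

end Coding

/-- Joint probability mass function of `(X, Y, U)` when `(X, Y) ∼ p` and `U` is generated by
the conditional probability mass function `W x y u = p(u | x, y)`. -/
def joint {α β υ : Type*} (p : α × β → ℝ) (W : α → β → υ → ℝ) : α × β × υ → ℝ :=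
  fun ω => p (ω.1, ω.2.1) * W ω.1 ω.2.1 ω.2.2

end EGW

end

/-! Converse. Take `U_i = (M₀, X^{i-1}, Y^{i-1})`. Since `M₀` is a function of the sources, the
chain rule gives `∑ H(X_i, Y_i | U_i) = H(X^n, Y^n) - H(M₀)`, which yields the bound on `R 0`. Each
remaining bound telescopes `H(M_k | U_i) - H(M_k | U_{i+1})` and applies Fano's inequality letter by
letter. The causal side information of decoders 3 and 4 at time `i` consists of the present letter
and a past already contained in `U_i`, so causality costs nothing (`sum_ent_hist_le_of_decoder`).

All five information quantities are affine in `H(X,Y|U)`, `H(X|U)`, `H(Y|U)` when the law of `(X,Y)`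
is fixed. The vectors formed by that law and these three entropies fill the convex hull `entHull` of
the points `(r, H(X,Y), H(X), H(Y))` with `r` in the simplex. Convexity replaces time sharing. The
simplex is connected and has total mass one, so Fenchel's form of Carathéodory's theorem
(`exists_combination_of_isPreconnected`) needs at most `|α||β| + 2` points, the asserted size of the
auxiliary alphabet. The same bound makes the hull compact, so the region it defines is closed and
contains the closure of the achievable tuples.

Achievability. A codebook of about `2^{nI}` words covers most source sequences
(`exists_typical_covering`). Since the encoder knows both sources, no binning is needed: each
private message names a letterwise map from what the decoder knows at time `i` to its estimate, and
about `2^{nH}` maps reproduce all likely sequences (`exists_dictionary`). Both facts come from the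
greedy covering argument `exists_covering`; a Chernoff bound controls the atypical sequences. -/

namespace EGW

/-! ### Entropy inequalities: Gibbs, submodularity, Fano -/

section Entropy

variable {Ω S T A : Type*} [Fintype Ω]

theorem nonempty_of_mem_stdSimplex {q : Ω → ℝ}
    (hq : q ∈ stdSimplex ℝ Ω) : Nonempty Ω := by
  by_contra h
  rw [not_nonempty_iff] at h
  have := hq.2
  simp at this

/-- Entropy in bits of the random variable `f` under `q`, as an expectation. -/
noncomputable def ent (q : Ω → ℝ) (f : Ω → S) : ℝ :=
  ∑ ω, q ω * -Real.logb 2 (law q f (f ω))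

theorem prob_eq_sum_ite (q : Ω → ℝ) (E : Set Ω) [DecidablePred (· ∈ E)] :
    prob q E = ∑ ω, if ω ∈ E then q ω else 0 := by
  simp [prob, Set.indicator_apply]

theorem law_eq_sum_ite [DecidableEq S] (q : Ω → ℝ) (f : Ω → S) (s : S) :
    law q f s = ∑ ω, if f ω = s then q ω else 0 := by
  simp [law, prob, Set.indicator_apply]

theorem prob_nonneg {q : Ω → ℝ} (hq : ∀ ω, 0 ≤ q ω) (E : Set Ω) : 0 ≤ prob q E :=
  Finset.sum_nonneg fun _ _ => Set.indicator_nonneg (fun _ _ => hq _) _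

theorem prob_mono {q : Ω → ℝ} (hq : ∀ ω, 0 ≤ q ω) {E F : Set Ω}
    (h : ∀ ω, 0 < q ω → ω ∈ E → ω ∈ F) : prob q E ≤ prob q F := by
  classical
  simp only [prob_eq_sum_ite]
  refine Finset.sum_le_sum fun ω _ => ?_
  rcases (hq ω).eq_or_lt with h0 | h0
  · simp [← h0]
  · by_cases h1 : ω ∈ E
    · simp [h1, h ω h0 h1]
    · rw [if_neg h1]
      split_ifs <;> simp [h0.le]

theorem prob_union_le {q : Ω → ℝ} (hq : ∀ ω, 0 ≤ q ω) (E F : Set Ω) :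
    prob q (E ∪ F) ≤ prob q E + prob q F := by
  classical
  simp only [prob_eq_sum_ite, ← Finset.sum_add_distrib]
  refine Finset.sum_le_sum fun ω _ => ?_
  have := hq ω
  by_cases h1 : ω ∈ E <;> by_cases h2 : ω ∈ F <;> simp [h1, h2, this]

theorem law_nonneg {q : Ω → ℝ} (hq : ∀ ω, 0 ≤ q ω) (f : Ω → S) (s : S) : 0 ≤ law q f s :=
  prob_nonneg hq _

theorem le_law {q : Ω → ℝ} (hq : ∀ ω, 0 ≤ q ω) (f : Ω → S) (ω : Ω) : q ω ≤ law q f (f ω) := by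
  classical
  rw [law_eq_sum_ite]
  refine le_trans (by simp) (Finset.single_le_sum (f := fun ω' => if f ω' = f ω then q ω' else 0)
    (fun i _ => ?_) (Finset.mem_univ ω))
  split_ifs <;> simp [hq]

theorem law_pos {q : Ω → ℝ} (hq : ∀ ω, 0 ≤ q ω) (f : Ω → S) {ω : Ω} (h : 0 < q ω) :
    0 < law q f (f ω) := h.trans_le (le_law hq f ω)

theorem law_mono {q : Ω → ℝ} (hq : ∀ ω, 0 ≤ q ω) {f : Ω → S} {g : Ω → T} {ω : Ω}
    (h : ∀ ω', g ω' = g ω → f ω' = f ω) : law q g (g ω) ≤ law q f (f ω) :=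
  prob_mono hq fun ω' _ hω' => h ω' hω'

theorem sum_law_mul [Fintype S] (q : Ω → ℝ) (f : Ω → S) (F : S → ℝ) :
    ∑ s, law q f s * F s = ∑ ω, q ω * F (f ω) := by
  classical
  simp only [law_eq_sum_ite, Finset.sum_mul]
  rw [Finset.sum_comm]
  simp [ite_mul]

theorem sum_law [Fintype S] (q : Ω → ℝ) (f : Ω → S) : ∑ s, law q f s = ∑ ω, q ω := by
  simpa using sum_law_mul q f fun _ => 1

theorem law_comp [Fintype S] (q : Ω → ℝ) (f : Ω → S) (g : S → T) (t : T) :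
    law (law q f) g t = law q (fun ω => g (f ω)) t := by
  classical
  have := sum_law_mul q f fun s => if g s = t then 1 else 0
  simpa [law_eq_sum_ite] using this

theorem law_id (q : Ω → ℝ) (ω : Ω) : law q (fun ω => ω) ω = q ω := by
  classical
  simp [law_eq_sum_ite]

theorem ent_law [Fintype S] (q : Ω → ℝ) (f : Ω → S) (g : S → T) :
    ent (law q f) g = ent q fun ω => g (f ω) := by
  unfold ent
  rw [sum_law_mul q f fun s => -Real.logb 2 (law (law q f) g (g s))]
  simp [law_comp]

/-- Entropy of a random variable on a finite type as a sum over its values. -/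
theorem ent_eq_sum_law [Fintype S] (q : Ω → ℝ) (f : Ω → S) :
    ent q f = ∑ s, law q f s * -Real.logb 2 (law q f s) :=
  (sum_law_mul q f fun s => -Real.logb 2 (law q f s)).symm

/-- Entropy depends only on the partition into level sets. This justifies every reordering of tuples
and every removal of redundant components below. -/
theorem ent_congr {q : Ω → ℝ} {f : Ω → S} {g : Ω → T}
    (h : ∀ ω ω', f ω' = f ω ↔ g ω' = g ω) : ent q f = ent q g := by
  unfold ent
  refine Finset.sum_congr rfl fun ω _ => ?_
  have : {ω' | f ω' = f ω} = {ω' | g ω' = g ω} := by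
    ext ω'; exact h ω ω'
  simp [law, this]

theorem ent_mono {q : Ω → ℝ} (hq : ∀ ω, 0 ≤ q ω) {f : Ω → S} {g : Ω → T}
    (h : ∀ ω ω', g ω' = g ω → f ω' = f ω) : ent q f ≤ ent q g := by
  refine Finset.sum_le_sum fun ω _ => ?_
  rcases (hq ω).eq_or_lt with h0 | h0
  · simp [← h0]
  · refine mul_le_mul_of_nonneg_left (neg_le_neg ?_) h0.le
    exact Real.logb_le_logb_of_le (by norm_num) (law_pos hq g h0) (law_mono hq (h ω))

/-- Every law is positive at points of positive mass, so the logarithm of the quotient splits there.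
Information inequalities thereby become linear arithmetic in joint entropies. -/
theorem condEntropy_eq [Fintype S] [Fintype T] {q : Ω → ℝ} (hq : ∀ ω, 0 ≤ q ω)
    (f : Ω → S) (g : Ω → T) :
    condEntropy q f g = ent q (fun ω => (f ω, g ω)) - ent q g := by
  unfold condEntropy
  rw [← Fintype.sum_prod_type', sum_law_mul q (fun ω => (f ω, g ω))
    (fun st => Real.logb 2 (law q (fun ω => (f ω, g ω)) (st.1, st.2) / law q g st.2)),
    ent, ent, ← Finset.sum_sub_distrib, ← Finset.sum_neg_distrib]
  refine Finset.sum_congr rfl fun ω _ => ?_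
  rcases (hq ω).eq_or_lt with h0 | h0
  · simp [← h0]
  · rw [Real.logb_div (law_pos hq (fun ω => (f ω, g ω)) h0).ne' (law_pos hq g h0).ne']
    ring

theorem mutualInfo_eq [Fintype S] [Fintype T] {q : Ω → ℝ} (hq : ∀ ω, 0 ≤ q ω)
    (f : Ω → S) (g : Ω → T) :
    mutualInfo q f g = ent q f + ent q g - ent q (fun ω => (f ω, g ω)) := by
  unfold mutualInfo
  rw [← Fintype.sum_prod_type', sum_law_mul q (fun ω => (f ω, g ω))
    (fun st => Real.logb 2 (law q (fun ω => (f ω, g ω)) (st.1, st.2) /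
      (law q f st.1 * law q g st.2))),
    ent, ent, ent, ← Finset.sum_add_distrib, ← Finset.sum_sub_distrib]
  refine Finset.sum_congr rfl fun ω _ => ?_
  rcases (hq ω).eq_or_lt with h0 | h0
  · simp [← h0]
  · have hf := (law_pos hq f h0).ne'
    have hg := (law_pos hq g h0).ne'
    rw [Real.logb_div (law_pos hq (fun ω => (f ω, g ω)) h0).ne' (mul_ne_zero hf hg),
      Real.logb_mul hf hg]
    ring

/-- Gibbs' inequality for conditional entropy. -/
theorem ent_sub_le_cross [Fintype S] [Fintype T] {q : Ω → ℝ} (hq : q ∈ stdSimplex ℝ Ω)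
    (f : Ω → S) (g : Ω → T) (F : S → T → ℝ) (hF : ∀ s t, 0 ≤ F s t)
    (hF1 : ∀ t, ∑ s, F s t ≤ 1) (hpos : ∀ ω, 0 < q ω → 0 < F (f ω) (g ω)) :
    ent q (fun ω => (f ω, g ω)) - ent q g ≤ ∑ ω, q ω * -Real.logb 2 (F (f ω) (g ω)) := by
  obtain ⟨hq0, hq1⟩ := hq
  set P := law q (fun ω => (f ω, g ω)) with hP
  set G := law q g with hG
  have hlog2 : 0 < Real.log 2 := Real.log_pos (by norm_num)
  -- By `log t ≤ t - 1`, the claim reduces to the mean likelihood ratio of the test law `F · G`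
  -- against the true law `P` being at most one.
  have key : ∑ ω, q ω * (F (f ω) (g ω) * G (g ω) / P (f ω, g ω)) ≤ 1 := by
    rw [← sum_law_mul q (fun ω => (f ω, g ω)) (fun st => F st.1 st.2 * G st.2 / P st)]
    calc ∑ st, P st * (F st.1 st.2 * G st.2 / P st)
        ≤ ∑ st : S × T, F st.1 st.2 * G st.2 := by
          refine Finset.sum_le_sum fun st _ => ?_
          have h0 : 0 ≤ F st.1 st.2 * G st.2 := mul_nonneg (hF _ _) (law_nonneg hq0 _ _)
          rcases eq_or_ne (P st) 0 with h | h
          · simpa [h] using h0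
          · rw [mul_div_cancel₀ _ h]
      _ = ∑ t, (∑ s, F s t) * G t := by
          rw [Fintype.sum_prod_type_right]
          simp [Finset.sum_mul]
      _ ≤ ∑ t, 1 * G t := Finset.sum_le_sum fun t _ =>
          mul_le_mul_of_nonneg_right (hF1 t) (law_nonneg hq0 _ _)
      _ = 1 := by simp [hG, sum_law, hq1]
  have : ent q (fun ω => (f ω, g ω)) - ent q g - ∑ ω, q ω * -Real.logb 2 (F (f ω) (g ω))
      ≤ ∑ ω, (q ω * (F (f ω) (g ω) * G (g ω) / P (f ω, g ω)) - q ω) / Real.log 2 := by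
    rw [ent, ent, ← Finset.sum_sub_distrib, ← Finset.sum_sub_distrib]
    refine Finset.sum_le_sum fun ω _ => ?_
    rcases (hq0 ω).eq_or_lt with h0 | h0
    · simp [← h0]
    · have h1 : 0 < P (f ω, g ω) := law_pos hq0 (fun ω => (f ω, g ω)) h0
      have h2 : 0 < G (g ω) := law_pos hq0 g h0
      have h3 := hpos ω h0
      have h4 := Real.log_le_sub_one_of_pos (div_pos (mul_pos h3 h2) h1)
      rw [Real.log_div (mul_pos h3 h2).ne' h1.ne', Real.log_mul h3.ne' h2.ne'] at h4
      have h5 := mul_le_mul_of_nonneg_left h4 h0.le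
      rw [le_div_iff₀ hlog2]
      have : (q ω * -Real.logb 2 (P (f ω, g ω)) - q ω * -Real.logb 2 (G (g ω)) -
          q ω * -Real.logb 2 (F (f ω) (g ω))) * Real.log 2 =
          q ω * (Real.log (F (f ω) (g ω)) + Real.log (G (g ω)) - Real.log (P (f ω, g ω))) := by
        simp only [Real.logb]
        field_simp
        ring
      rw [this]
      linarith
  rw [← Finset.sum_div, Finset.sum_sub_distrib, hq1] at this
  have : ent q (fun ω => (f ω, g ω)) - ent q g - ∑ ω, q ω * -Real.logb 2 (F (f ω) (g ω)) ≤ 0 :=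
    this.trans (div_nonpos_of_nonpos_of_nonneg (by linarith) hlog2.le)
  linarith

/-- Conditioning reduces entropy: `H(f | g, h) ≤ H(f | h)`. -/
theorem ent_submodular [Fintype S] [Fintype T] [Fintype A] {q : Ω → ℝ}
    (hq : q ∈ stdSimplex ℝ Ω) (f : Ω → S) (g : Ω → T) (h : Ω → A) :
    ent q (fun ω => (f ω, g ω, h ω)) - ent q (fun ω => (g ω, h ω)) ≤
      ent q (fun ω => (f ω, h ω)) - ent q h := by
  -- The test kernel is the conditional law of `f` given `h`, which ignores `g`. Where `h` has mass
  -- zero it vanishes, which is why Gibbs' inequality is stated for subprobability kernels.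
  refine (ent_sub_le_cross hq f (fun ω => (g ω, h ω))
    (fun s t => law q (fun ω => (f ω, h ω)) (s, t.2) / law q h t.2)
    (fun s t => div_nonneg (law_nonneg hq.1 _ _) (law_nonneg hq.1 _ _)) (fun t => ?_)
    (fun ω hω => div_pos (law_pos hq.1 (fun ω => (f ω, h ω)) hω) (law_pos hq.1 h hω))).trans_eq ?_
  · rw [← Finset.sum_div]
    have : ∑ s, law q (fun ω => (f ω, h ω)) (s, t.2) = law q h t.2 := by
      classical
      simp only [law_eq_sum_ite]
      rw [Finset.sum_comm]
      refine Finset.sum_congr rfl fun ω _ => ?_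
      by_cases hh : h ω = t.2 <;> simp [hh]
    rw [this]
    exact div_self_le_one _
  · rw [ent, ent, ← Finset.sum_sub_distrib]
    refine Finset.sum_congr rfl fun ω _ => ?_
    rcases (hq.1 ω).eq_or_lt with h0 | h0
    · simp [← h0]
    · rw [Real.logb_div (law_pos hq.1 (fun ω => (f ω, h ω)) h0).ne' (law_pos hq.1 h h0).ne']
      ring

/-- `H(f | g)` is at most the logarithm of the number of values of `f`. -/
theorem ent_sub_le_logb_card [Fintype S] [Fintype T] {q : Ω → ℝ} (hq : q ∈ stdSimplex ℝ Ω)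
    (f : Ω → S) (g : Ω → T) :
    ent q (fun ω => (f ω, g ω)) - ent q g ≤ Real.logb 2 (Fintype.card S) := by
  obtain ⟨ω₀⟩ := nonempty_of_mem_stdSimplex hq
  have hc : (0 : ℝ) < Fintype.card S := by
    exact_mod_cast Fintype.card_pos_iff.2 ⟨f ω₀⟩
  have h := ent_sub_le_cross hq f g (fun _ _ => (Fintype.card S : ℝ)⁻¹)
    (fun _ _ => by positivity) (fun _ => by simp [hc.ne']) (fun _ _ => by positivity)
  rw [← Finset.sum_mul, hq.2] at h
  simpa using h

theorem ent_le_logb_card [Fintype S] {q : Ω → ℝ} (hq : q ∈ stdSimplex ℝ Ω) (f : Ω → S) :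
    ent q f ≤ Real.logb 2 (Fintype.card S) := by
  have h := ent_sub_le_logb_card hq f fun _ => ()
  have h1 : ent q (fun _ => ()) = 0 := by simp [ent, law, prob, hq.2]
  rwa [h1, sub_zero, ent_congr (g := f) (by simp)] at h

/-- Fano's inequality, with a free parameter `δ` in place of the binary entropy. -/
theorem ent_sub_le_of_decoder [Fintype S] [Fintype T] {q : Ω → ℝ} (hq : q ∈ stdSimplex ℝ Ω)
    (f : Ω → S) (g : Ω → T) (d : T → S) {e δ : ℝ} (he : prob q {ω | d (g ω) ≠ f ω} ≤ e)
    (hδ : 0 < δ) (hδ1 : δ < 1) :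
    ent q (fun ω => (f ω, g ω)) - ent q g ≤
      -Real.logb 2 (1 - δ) + e * Real.logb 2 (Fintype.card S / δ) := by
  classical
  have hne : Nonempty S := (nonempty_of_mem_stdSimplex hq).map f
  have hc1 : (1 : ℝ) ≤ Fintype.card S := by exact_mod_cast Fintype.card_pos
  have hc : (0 : ℝ) < Fintype.card S := by linarith
  have hL : 0 ≤ Real.logb 2 (Fintype.card S / δ) :=
    Real.logb_nonneg (by norm_num) (by rw [le_div_iff₀ hδ]; linarith)
  -- The test kernel trusts the decoder with weight `1 - δ` and spreads `δ` uniformly: a correct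
  -- guess costs at most `-log (1 - δ)`, an error costs `log (|S| / δ)`.
  refine (ent_sub_le_cross hq f g (fun s t => (if d t = s then 1 - δ else 0) + δ / Fintype.card S)
    (fun s t => ?_) (fun t => ?_) (fun ω _ => ?_)).trans ?_
  · have : 0 ≤ δ / Fintype.card S := by positivity
    split_ifs <;> linarith
  · simp [Finset.sum_add_distrib, mul_div_cancel₀ _ hc.ne']
  · have : 0 < δ / Fintype.card S := by positivity
    split_ifs <;> linarith
  · have hpt : ∀ ω, q ω * -Real.logb 2 ((if d (g ω) = f ω then 1 - δ else 0) + δ / Fintype.card S)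
        ≤ q ω * -Real.logb 2 (1 - δ) +
          (if ω ∈ {ω | d (g ω) ≠ f ω} then q ω else 0) * Real.logb 2 (Fintype.card S / δ) := by
      intro ω
      have hlog : 0 ≤ -Real.logb 2 (1 - δ) := by
        rw [neg_nonneg]
        exact Real.logb_nonpos (by norm_num) (by linarith) (by linarith)
      have hpos : 0 < δ / Fintype.card S := by positivity
      by_cases h : d (g ω) = f ω
      · simp only [h, if_true, Set.mem_ofPred_eq, ne_eq, not_true, if_false, zero_mul, add_zero]
        refine mul_le_mul_of_nonneg_left (neg_le_neg ?_) (hq.1 ω)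
        exact Real.logb_le_logb_of_le (by norm_num) (by linarith) (by linarith)
      · simp only [h, if_false, Set.mem_ofPred_eq, ne_eq, not_false_iff, if_true, zero_add]
        rw [← Real.logb_inv, inv_div]
        have := mul_nonneg (hq.1 ω) hlog
        linarith
    refine (Finset.sum_le_sum fun ω _ => hpt ω).trans ?_
    rw [Finset.sum_add_distrib, ← Finset.sum_mul, ← Finset.sum_mul, hq.2, one_mul,
      ← prob_eq_sum_ite]
    gcongr

end Entropy

/-! ### Product measures -/

section IID

variable {A : Type*}

/-- The law of `n` independent variables with probability mass function `p`. -/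
def iid (p : A → ℝ) (n : ℕ) : (Fin n → A) → ℝ := fun z => ∏ i, p (z i)

theorem iid_nonneg {p : A → ℝ} (hp : ∀ a, 0 ≤ p a) (n : ℕ) (z : Fin n → A) : 0 ≤ iid p n z :=
  Finset.prod_nonneg fun _ _ => hp _

variable [Fintype A]

theorem sum_prod_pi {ι : Type*} [Fintype ι] [DecidableEq ι] (g : ι → A → ℝ) :
    ∑ z : ι → A, ∏ i, g i (z i) = ∏ i, ∑ a, g i a := by
  rw [Finset.prod_univ_sum, Fintype.piFinset_univ]

theorem iid_mem_stdSimplex {p : A → ℝ} (hp : p ∈ stdSimplex ℝ A) (n : ℕ) :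
    iid p n ∈ stdSimplex ℝ (Fin n → A) := by
  refine ⟨iid_nonneg hp.1 n, ?_⟩
  unfold iid
  rw [sum_prod_pi fun _ a => p a]
  simp [hp.2]

theorem sum_iid_mul_apply {p : A → ℝ} (hp : p ∈ stdSimplex ℝ A) {n : ℕ} (i : Fin n) (f : A → ℝ) :
    ∑ z, iid p n z * f (z i) = ∑ a, p a * f a := by
  have h := sum_prod_pi fun (j : Fin n) a => p a * (if j = i then f a else 1)
  rw [Finset.prod_eq_single i] at h
  · simp only [Finset.prod_mul_distrib] at h
    simpa [iid] using h
  · intro j _ hj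
    simp [hj, hp.2]
  · simp

theorem law_iid_apply {p : A → ℝ} (hp : p ∈ stdSimplex ℝ A) {n : ℕ} (i : Fin n) :
    law (iid p n) (fun z => z i) = p := by
  classical
  ext a
  have := sum_iid_mul_apply hp i fun b => if b = a then 1 else 0
  simpa [law_eq_sum_ite] using this

theorem ent_iid {p : A → ℝ} (hp : p ∈ stdSimplex ℝ A) (n : ℕ) :
    ent (iid p n) (fun z => z) = n * ent p (fun a => a) := by
  have h : ∀ z, iid p n z * -Real.logb 2 (law (iid p n) (fun z => z) z) =
      ∑ i, iid p n z * -Real.logb 2 (p (z i)) := by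
    intro z
    rw [law_id]
    rcases (iid_nonneg hp.1 n z).eq_or_lt with h0 | h0
    · simp [← h0]
    · rw [← Finset.mul_sum, Finset.sum_neg_distrib]
      have : ∀ i ∈ Finset.univ, p (z i) ≠ 0 := Finset.prod_ne_zero_iff.1 h0.ne'
      congr 2
      simp only [Real.logb]
      rw [iid, Real.log_prod this, Finset.sum_div]
  unfold ent
  rw [Finset.sum_congr rfl fun z _ => h z, Finset.sum_comm]
  simp only [sum_iid_mul_apply hp _ fun a => -Real.logb 2 (p a), law_id]
  simp

end IID

/-! ### Chain rule along the source history -/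

section History

variable {A B S N M : Type*} {n : ℕ}

/-- The message `m` together with the source letters before time `k`. -/
def hist (m : (Fin n → A) → N) (k : ℕ) (z : Fin n → A) : N × ({j : Fin n // j.val < k} → A) :=
  (m z, fun j => z j)

/-- The history at `k` stops strictly before `k`, so passing from `i` to `i + 1` adds exactly the
letter `z i`. This is what makes the sums over time telescope. -/
theorem hist_succ_eq_iff (m : (Fin n → A) → N) (i : Fin n) (z z' : Fin n → A) :
    hist m (i + 1) z = hist m (i + 1) z' ↔ z i = z' i ∧ hist m i z = hist m i z' := by
  simp only [hist, Prod.mk.injEq, funext_iff, Subtype.forall]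
  constructor
  · rintro ⟨h1, h2⟩
    exact ⟨h2 i (by omega), h1, fun j hj => h2 j (by omega)⟩
  · rintro ⟨h1, h2, h3⟩
    refine ⟨h2, fun j hj => ?_⟩
    rcases Nat.lt_succ_iff_lt_or_eq.1 hj with h | h
    · exact h3 j h
    · rw [Fin.ext h, h1]

theorem sum_fin_sub_succ (n : ℕ) (g : ℕ → ℝ) :
    ∑ i : Fin n, (g i - g (i + 1)) = g 0 - g n := by
  rw [Fin.sum_univ_eq_sum_range (fun i => g i - g (i + 1)), Finset.sum_range_sub']

variable [Fintype A]

theorem ent_hist_zero (q : (Fin n → A) → ℝ) (m : (Fin n → A) → N) :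
    ent q (hist m 0) = ent q m :=
  ent_congr fun z z' => by simp [hist, funext_iff]

theorem ent_hist_last (q : (Fin n → A) → ℝ) (m : (Fin n → A) → N) :
    ent q (hist m n) = ent q (fun z => z) := by
  refine ent_congr fun z z' => ⟨fun h => ?_, fun h => by rw [h]⟩
  ext i
  exact congr_fun (congr_arg Prod.snd h) ⟨i, i.2⟩

/-- Chain rule for the whole source sequence given a function of it. -/
theorem sum_ent_hist (q : (Fin n → A) → ℝ) (m : (Fin n → A) → N) :
    ∑ i : Fin n, (ent q (fun z => (z i, hist m i z)) - ent q (hist m i)) =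
      ent q (fun z => z) - ent q m := by
  have h : ∀ i : Fin n, ent q (fun z => (z i, hist m i z)) = ent q (hist m (i + 1)) := fun i =>
    ent_congr fun z z' => by rw [hist_succ_eq_iff, Prod.mk.injEq]
  have h2 := sum_fin_sub_succ n fun k => -ent q (hist m k)
  simp only [ent_hist_zero, ent_hist_last, sub_neg_eq_add] at h2
  rw [show ent q (fun z => z) - ent q m = -ent q m + ent q fun z => z by ring, ← h2]
  refine Finset.sum_congr rfl fun i _ => ?_
  rw [h]
  ring

variable [Fintype B] [Fintype S] [Fintype N] [Fintype M]

/-- If a message `m`, side information `σ (z i)` and the history determine `φ (z i)` up to a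
small error probability for all `i`, then the conditional entropies of `φ (z i)` sum to
little more than the logarithm of the number of messages. -/
theorem sum_ent_hist_le_of_decoder {q : (Fin n → A) → ℝ} (hq : q ∈ stdSimplex ℝ (Fin n → A))
    (m₀ : (Fin n → A) → N) (m : (Fin n → A) → M) (φ : A → B) (σ : A → S)
    (d : (i : Fin n) → M × S × N × ({j : Fin n // j.val < i.val} → A) → B) {e δ : ℝ}
    (he : ∀ i : Fin n, prob q {z | d i (m z, σ (z i), hist m₀ i z) ≠ φ (z i)} ≤ e)
    (hδ : 0 < δ) (hδ1 : δ < 1) :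
    ∑ i : Fin n, (ent q (fun z => (φ (z i), σ (z i), hist m₀ i z)) -
        ent q (fun z => (σ (z i), hist m₀ i z))) ≤
      Real.logb 2 (Fintype.card M) +
        n * (-Real.logb 2 (1 - δ) + e * Real.logb 2 (Fintype.card B / δ)) := by
  classical
  set F := -Real.logb 2 (1 - δ) + e * Real.logb 2 (Fintype.card B / δ)
  -- The telescoping quantity is the uncertainty `H(m | history at k)`, between `0` and `log |M|` at
  -- the two ends.
  set g : ℕ → ℝ := fun k => ent q (fun z => (m z, hist m₀ k z)) - ent q (hist m₀ k) with hg
  -- With `V` the history, `H(φ|σ,V) = H(φ|m,σ,V) + H(m|σ,V) - H(m|φ,σ,V)`. Fano bounds the first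
  -- term; removing `σ` from the second condition and adding `z i` to the third turns the rest into
  -- `g i - g (i + 1)`.
  have hstep : ∀ i : Fin n, ent q (fun z => (φ (z i), σ (z i), hist m₀ i z)) -
      ent q (fun z => (σ (z i), hist m₀ i z)) ≤ (g i - g (i + 1)) + F := by
    intro i
    have h1 := ent_sub_le_of_decoder hq (fun z => φ (z i))
      (fun z => (m z, σ (z i), hist m₀ i z)) (d i) (he i) hδ hδ1
    have h2 := ent_submodular hq m (fun z => σ (z i)) (hist m₀ i)
    have h3 := ent_submodular hq m (fun z => z i) (fun z => (φ (z i), σ (z i), hist m₀ i z))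
    have h4 : ent q (fun z => (φ (z i), m z, σ (z i), hist m₀ i z)) =
        ent q (fun z => (m z, φ (z i), σ (z i), hist m₀ i z)) :=
      ent_congr fun z z' => by simp only [Prod.mk.injEq]; tauto
    have h5 : ent q (fun z => (m z, z i, φ (z i), σ (z i), hist m₀ i z)) =
        ent q (fun z => (m z, hist m₀ (i + 1) z)) :=
      ent_congr fun z z' => by
        simp only [Prod.mk.injEq, hist_succ_eq_iff]
        exact ⟨by tauto, fun ⟨h1, h2, h3⟩ => ⟨h1, h2, by rw [h2], by rw [h2], h3⟩⟩
    have h6 : ent q (fun z => (z i, φ (z i), σ (z i), hist m₀ i z)) =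
        ent q (hist m₀ (i + 1)) :=
      ent_congr fun z z' => by
        simp only [Prod.mk.injEq, hist_succ_eq_iff]
        exact ⟨by tauto, fun ⟨h2, h3⟩ => ⟨h2, by rw [h2], by rw [h2], h3⟩⟩
    simp only [hg]
    linarith
  have h0 : g 0 ≤ Real.logb 2 (Fintype.card M) := ent_sub_le_logb_card hq m (hist m₀ 0)
  have hn : 0 ≤ g n := sub_nonneg.2 (ent_mono hq.1 fun z z' h => (Prod.mk.inj h).2)
  refine (Finset.sum_le_sum fun i _ => hstep i).trans ?_
  rw [Finset.sum_add_distrib, sum_fin_sub_succ]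
  simp only [Finset.sum_const, Finset.card_univ, Fintype.card_fin, nsmul_eq_mul]
  linarith

end History

/-! ### The hull of entropy points -/

section Hull

variable {Ω T α β : Type*} [Fintype Ω] [Fintype α] [Fintype β]

/-- A probability mass function on `α × β` with its joint and marginal entropies. -/
noncomputable def entPoint (r : α × β → ℝ) : (α × β → ℝ) × ℝ × ℝ × ℝ :=
  (r, ent r (fun a => a), ent r Prod.fst, ent r Prod.snd)

variable (α β) in
/-- Convex hull of the points `(r, H(X, Y), H(X), H(Y))` for `(X, Y) ∼ r`. -/
noncomputable def entHull : Set ((α × β → ℝ) × ℝ × ℝ × ℝ) :=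
  convexHull ℝ (entPoint '' stdSimplex ℝ (α × β))

theorem continuous_ent {A S : Type*} [Fintype A] [Fintype S] (f : A → S) :
    Continuous fun r : A → ℝ => ent r f := by
  classical
  have : (fun r : A → ℝ => ent r f) =
      fun r => ∑ s, Real.negMulLog (law r f s) / Real.log 2 := by
    ext r
    rw [ent_eq_sum_law]
    refine Finset.sum_congr rfl fun s _ => ?_
    rw [Real.negMulLog, Real.logb]
    ring
  rw [this]
  refine continuous_finsetSum _ fun s _ => (Real.continuous_negMulLog.comp ?_).div_const _
  simp only [law_eq_sum_ite]
  refine continuous_finsetSum _ fun a _ => ?_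
  split_ifs <;> fun_prop

theorem continuous_entPoint : Continuous (entPoint (α := α) (β := β)) :=
  continuous_id.prodMk ((continuous_ent _).prodMk ((continuous_ent _).prodMk (continuous_ent _)))

/-- Conditional law of `Z` given `V = t`. -/
noncomputable def condLaw {A : Type*} (q : Ω → ℝ) (Z : Ω → A) (V : Ω → T) (t : T) (a : A) : ℝ :=
  law q (fun ω => (Z ω, V ω)) (a, t) / law q V t

theorem sum_law_pair_right {A : Type*} [Fintype A] (q : Ω → ℝ) (Z : Ω → A) (V : Ω → T) (t : T) :
    ∑ a, law q (fun ω => (Z ω, V ω)) (a, t) = law q V t := by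
  classical
  simp only [law_eq_sum_ite]
  rw [Finset.sum_comm]
  refine Finset.sum_congr rfl fun ω _ => ?_
  by_cases h : V ω = t <;> simp [h]

theorem condLaw_mem_stdSimplex {A : Type*} [Fintype A] {q : Ω → ℝ} (hq : ∀ ω, 0 ≤ q ω) (Z : Ω → A)
    (V : Ω → T) {t : T} (ht : law q V t ≠ 0) : condLaw q Z V t ∈ stdSimplex ℝ A := by
  refine ⟨fun a => div_nonneg (law_nonneg hq _ _) (law_nonneg hq _ _), ?_⟩
  simp only [condLaw]
  rw [← Finset.sum_div, sum_law_pair_right, div_self ht]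

theorem law_mul_condLaw {A : Type*} {q : Ω → ℝ} (hq : ∀ ω, 0 ≤ q ω) (Z : Ω → A) (V : Ω → T)
    (t : T) (a : A) :
    law q V t * condLaw q Z V t a = law q (fun ω => (Z ω, V ω)) (a, t) := by
  by_cases ht : law q V t = 0
  · rw [ht, zero_mul]
    refine le_antisymm (law_nonneg hq _ _) ?_
    rw [← ht]
    exact prob_mono hq fun ω _ hω => (Prod.mk.inj hω).2
  · rw [condLaw, mul_div_cancel₀ _ ht]

variable [Fintype T]

theorem law_condLaw {A B : Type*} [Fintype A] (q : Ω → ℝ) (Z : Ω → A) (V : Ω → T) (t : T)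
    (f : A → B) (b : B) :
    law (condLaw q Z V t) f b = law q (fun ω => (f (Z ω), V ω)) (b, t) / law q V t := by
  classical
  have h := law_comp q (fun ω => (Z ω, V ω)) (fun at' => (f at'.1, at'.2)) (b, t)
  rw [← h, law_eq_sum_ite, law_eq_sum_ite, Fintype.sum_prod_type, Finset.sum_div]
  refine Finset.sum_congr rfl fun a _ => ?_
  by_cases hf : f a = b <;> simp [hf, condLaw]

theorem sum_law_pair_left {A : Type*} (q : Ω → ℝ) (Z : Ω → A) (V : Ω → T) (a : A) :
    ∑ t, law q (fun ω => (Z ω, V ω)) (a, t) = law q Z a := by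
  classical
  simp only [law_eq_sum_ite]
  rw [Finset.sum_comm]
  refine Finset.sum_congr rfl fun ω _ => ?_
  by_cases h : Z ω = a <;> simp [h]

theorem sum_law_mul_ent_condLaw {A B : Type*} [Fintype A] [Fintype B] {q : Ω → ℝ}
    (hq : ∀ ω, 0 ≤ q ω) (Z : Ω → A) (V : Ω → T) (f : A → B) :
    ∑ t, law q V t * ent (condLaw q Z V t) f = condEntropy q (fun ω => f (Z ω)) V := by
  simp only [ent_eq_sum_law, Finset.mul_sum, law_condLaw, condEntropy]
  rw [Finset.sum_comm, ← Finset.sum_neg_distrib]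
  refine Finset.sum_congr rfl fun b _ => ?_
  rw [← Finset.sum_neg_distrib]
  refine Finset.sum_congr rfl fun t _ => ?_
  rw [← mul_assoc]
  have := law_mul_condLaw hq (fun ω => f (Z ω)) V t b
  rw [condLaw] at this
  rw [this]
  ring

/-- The conditional laws of `Z` given `V = t`, weighted by the law of `V`, average to the law of
`Z`, and their entropies average to the conditional entropies. -/
theorem condEntropy_mem_entHull {q : Ω → ℝ} (hq : q ∈ stdSimplex ℝ Ω) (Z : Ω → α × β)
    (V : Ω → T) :
    (law q Z, condEntropy q Z V, condEntropy q (fun ω => (Z ω).1) V,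
      condEntropy q (fun ω => (Z ω).2) V) ∈ entHull α β := by
  classical
  -- Null values of `V` are set aside because there `condLaw` is the zero function, which is not in
  -- the simplex; their weight zero lets them return afterwards.
  have key : ∑ t with law q V t ≠ 0, law q V t • entPoint (condLaw q Z V t) ∈ entHull α β := by
    refine (convex_convexHull ℝ _).sum_mem (fun t _ => law_nonneg hq.1 _ _) ?_ fun t ht =>
      subset_convexHull ℝ _ ⟨_, condLaw_mem_stdSimplex hq.1 Z V (Finset.mem_filter.1 ht).2, rfl⟩
    rw [Finset.sum_filter_ne_zero, sum_law, hq.2]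
  rw [Finset.sum_filter_of_ne (p := fun t => law q V t ≠ 0)
    (fun t _ h h0 => h (by rw [h0, zero_smul]))] at key
  have hsum : ∑ t, law q V t • entPoint (condLaw q Z V t) =
      (law q Z, condEntropy q Z V, condEntropy q (fun ω => (Z ω).1) V,
        condEntropy q (fun ω => (Z ω).2) V) := by
    simp only [entPoint, Prod.smul_mk, smul_eq_mul]
    refine Prod.ext ?_ (Prod.ext ?_ (Prod.ext ?_ ?_))
    · ext a
      simp [Prod.fst_sum, law_mul_condLaw hq.1, sum_law_pair_left]
    · simp [Prod.fst_sum, Prod.snd_sum, sum_law_mul_ent_condLaw hq.1]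
    · simp [Prod.fst_sum, Prod.snd_sum, sum_law_mul_ent_condLaw hq.1]
    · simp [Prod.snd_sum, sum_law_mul_ent_condLaw hq.1]
  rwa [hsum] at key

end Hull

/-! ### Fenchel's refinement of Carathéodory's theorem -/

section Caratheodory

variable {E : Type*} [NormedAddCommGroup E] [NormedSpace ℝ E]

theorem sum_subtype_smul {ι F : Type*} [Fintype ι] [AddCommGroup F] [Module ℝ F] (P : ι → Prop)
    [DecidablePred P] {v : ι → ℝ} (hv : ∀ i, ¬ P i → v i = 0) (f : ι → F) :
    ∑ i : {i // P i}, v i • f i = ∑ i, v i • f i := by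
  rw [← Finset.sum_subtype (Finset.univ.filter P) (by simp) fun i => v i • f i]
  refine Finset.sum_filter_of_ne fun i _ h => ?_
  by_contra hi
  exact h (by rw [hv i hi, zero_smul])

theorem exists_fin_of_fintype_combination {S : Set E} {x : E} {ι : Type*} [Fintype ι] {w : ι → ℝ}
    {y : ι → E} (hw : w ∈ stdSimplex ℝ ι) (hy : ∀ i, y i ∈ S) (hx : ∑ i, w i • y i = x) :
    ∃ (w : Fin (Fintype.card ι) → ℝ) (y : Fin (Fintype.card ι) → E),
      w ∈ stdSimplex ℝ (Fin (Fintype.card ι)) ∧ (∀ i, y i ∈ S) ∧ ∑ i, w i • y i = x := by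
  let e := (Fintype.equivFin ι).symm
  refine ⟨fun i => w (e i), fun i => y (e i), ⟨fun i => hw.1 _, ?_⟩, fun i => hy _, ?_⟩
  · rw [← hw.2, Equiv.sum_comp e w]
  · rw [← hx, Equiv.sum_comp e fun i => w i • y i]

variable [FiniteDimensional ℝ E]

/-- Fenchel's sharpening of Carathéodory's theorem for connected sets: if `S` is connected and
lies in an affine hyperplane missing the origin, then every point of its convex hull is a convex
combination of fewer than `finrank ℝ E` points of `S`. -/
theorem exists_combination_of_isPreconnected {S : Set E} (hS : IsPreconnected S) (l : E →ₗ[ℝ] ℝ)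
    (hl : ∀ s ∈ S, l s = 1) (hE : 2 ≤ Module.finrank ℝ E) {x : E} (hx : x ∈ convexHull ℝ S) :
    ∃ k ≤ Module.finrank ℝ E - 1, ∃ (w : Fin k → ℝ) (y : Fin k → E),
      w ∈ stdSimplex ℝ (Fin k) ∧ (∀ i, y i ∈ S) ∧ ∑ i, w i • y i = x := by
  classical
  obtain ⟨ι, _, z, w, hz, haff, hw, hw1, hwx⟩ := eq_pos_convex_span_of_mem_convexHull hx
  replace hz : ∀ i, z i ∈ S := fun i => hz ⟨i, rfl⟩
  -- Applying `l` to a linear relation shows that its coefficients sum to zero, so affine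
  -- independence suffices.
  have hlin : LinearIndependent ℝ z := by
    rw [Fintype.linearIndependent_iff]
    intro g hg i
    refine affineIndependent_iff.1 haff Finset.univ g ?_ hg i (Finset.mem_univ i)
    have := congr_arg l hg
    simpa [map_sum, hl _ (hz _)] using this
  by_cases hcard : Fintype.card ι ≤ Module.finrank ℝ E - 1
  · exact ⟨_, hcard, exists_fin_of_fintype_combination ⟨fun i => (hw i).le, hw1⟩ hz hwx⟩
  have hcard' : Fintype.card ι = Module.finrank ℝ E :=
    le_antisymm hlin.fintype_card_le_finrank (by omega)
  have : Nontrivial ι := Fintype.one_lt_card_iff_nontrivial.1 (by omega)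
  obtain ⟨i₀, i₁, hne⟩ := exists_pair_ne ι
  let b := basisOfLinearIndependentOfCardEqFinrank hlin hcard'
  have hb : ∀ i, b i = z i := fun i => by simp [b]
  -- In the remaining case the points form a basis. The closed sets `D i`, where the `i`-th ratio of
  -- coordinates to weights is largest, cover the space, and `z i ∈ D i`. Connectedness yields `s ∈
  -- S` whose largest ratio is attained at two indices.
  let r : ι → E → ℝ := fun i s => b.repr s i / w i
  have hr : ∀ i, Continuous (r i) := fun i =>
    ((b.coord i).continuous_of_finiteDimensional).div_const _
  let D : ι → Set E := fun i => {s | ∀ j, r j s ≤ r i s}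
  have hD : ∀ i, IsClosed (D i) := fun i => by
    simp only [D, Set.ofPred_forall]
    exact isClosed_iInter fun j => isClosed_le (hr j) (hr i)
  have hzD : ∀ i, z i ∈ D i := by
    intro i j
    simp only [r, ← hb, Module.Basis.repr_self]
    by_cases hij : i = j
    · simp [hij]
    · rw [Finsupp.single_eq_of_ne (Ne.symm hij), Finsupp.single_eq_same, zero_div]
      exact div_nonneg zero_le_one (hw i).le
  obtain ⟨s, hsS, hs₀, hs₁⟩ := isPreconnected_closed_iff.1 hS (D i₀) (⋃ i ∈ {i | i ≠ i₀}, D i)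
    (hD i₀) (Set.Finite.isClosed_biUnion (Set.toFinite _) fun i _ => hD i)
    (fun s _ => by
      obtain ⟨i, hi⟩ := Finite.exists_max fun i => r i s
      by_cases h : i = i₀
      · exact Or.inl (h ▸ hi)
      · exact Or.inr (Set.mem_biUnion (x := i) h hi))
    ⟨z i₀, hz _, hzD _⟩ ⟨z i₁, hz _, Set.mem_biUnion (x := i₁) hne.symm (hzD _)⟩
  simp only [Set.mem_iUnion] at hs₁
  obtain ⟨i₂, hi₂, hs₂⟩ := hs₁
  replace hi₂ : i₂ ≠ i₀ := hi₂
  set ρ := r i₀ s with hρ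
  have hρ₂ : r i₂ s = ρ := le_antisymm (hs₀ i₂) (hs₂ i₀)
  have hrepr : ∀ i, b.repr s i = r i s * w i := fun i => by
    simp only [r]; rw [div_mul_cancel₀ _ (hw i).ne']
  have hsum : ∑ i, r i s * w i = 1 := by
    have h := congr_arg l (b.sum_repr s)
    simp only [map_sum, map_smul, hb, hl _ (hz _), hl s hsS, smul_eq_mul, mul_one, hrepr] at h
    exact h
  have hρ0 : 0 < ρ := by
    by_contra! h
    have : ∑ i, r i s * w i ≤ 0 := Finset.sum_nonpos fun i _ =>
      mul_nonpos_of_nonpos_of_nonneg ((hs₀ i).trans h) (hw i).le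
    linarith
  -- Giving `s` the weight `ρ⁻¹` is the most that keeps the other weights nonnegative. It removes `z
  -- i₀` and `z i₂` at the price of the single new point `s`.
  let v : ι → ℝ := fun i => w i - ρ⁻¹ * (r i s * w i)
  have hv : ∀ i, 0 ≤ v i := fun i => by
    have h1 : ρ⁻¹ * r i s ≤ 1 := by
      rw [inv_mul_le_iff₀ hρ0, mul_one]
      exact hs₀ i
    have := mul_le_mul_of_nonneg_right h1 (hw i).le
    simp only [v]
    linarith
  have hv0 : ∀ i, ¬ (i ≠ i₀ ∧ i ≠ i₂) → v i = 0 := by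
    intro i hi
    have : r i s = ρ := by
      by_cases h : i = i₀
      · rw [h]
      · rw [show i = i₂ by tauto, hρ₂]
    simp only [v, this]
    field_simp
    simp
  refine ⟨Fintype.card (Option {i // i ≠ i₀ ∧ i ≠ i₂}), ?_,
    exists_fin_of_fintype_combination (w := fun o => o.elim ρ⁻¹ fun i => v i)
      (y := fun o => o.elim s fun i => z i) ⟨?_, ?_⟩ ?_ ?_⟩
  · have h1 : Fintype.card {i // i ≠ i₀ ∧ i ≠ i₂} = Fintype.card ι - 2 := by
      rw [Fintype.card_subtype]
      have : (Finset.univ.filter fun i => i ≠ i₀ ∧ i ≠ i₂) = (Finset.univ.erase i₀).erase i₂ := by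
        ext i; simp [and_comm]
      rw [this, Finset.card_erase_of_mem (by simp [hi₂]), Finset.card_erase_of_mem (by simp)]
      simp
      omega
    rw [Fintype.card_option, h1]
    omega
  · rintro (_ | i)
    · exact inv_nonneg.2 hρ0.le
    · exact hv i
  · rw [Fintype.sum_option]
    have := sum_subtype_smul _ hv0 fun _ => (1 : ℝ)
    simp only [smul_eq_mul, mul_one] at this
    simp only [Option.elim]
    rw [this]
    simp only [v]
    rw [Finset.sum_sub_distrib, ← Finset.mul_sum, hsum, hw1]
    ring
  · rintro (_ | i)
    · exact hsS
    · exact hz i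
  · rw [Fintype.sum_option]
    simp only [Option.elim]
    rw [sum_subtype_smul _ hv0 z]
    simp only [v, sub_smul, Finset.sum_sub_distrib, mul_smul, ← Finset.smul_sum, hwx]
    have := b.sum_repr s
    simp only [hb, hrepr, mul_smul] at this
    rw [this]
    abel

end Caratheodory

/-! ### Cardinality bound and compactness -/

section Hull

variable {α β : Type*} [Fintype α] [Fintype β]

/-- The ambient dimension is `|α||β| + 3`. The entropy points are a continuous image of the simplex,
hence connected, and lie on the hyperplane of total mass one; Fenchel's refinement therefore saves
one point. -/
theorem exists_combination_of_mem_entHull [Nonempty (α × β)] {v : (α × β → ℝ) × ℝ × ℝ × ℝ}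
    (hv : v ∈ entHull α β) :
    ∃ k ≤ Fintype.card α * Fintype.card β + 2,
      ∃ (w : Fin k → ℝ) (r : Fin k → α × β → ℝ), w ∈ stdSimplex ℝ (Fin k) ∧
        (∀ i, r i ∈ stdSimplex ℝ (α × β)) ∧ ∑ i, w i • entPoint (r i) = v := by
  have hrank : Module.finrank ℝ ((α × β → ℝ) × ℝ × ℝ × ℝ) =
      Fintype.card α * Fintype.card β + 3 := by simp
  obtain ⟨k, hk, w, y, hw, hy, h⟩ := exists_combination_of_isPreconnected
    (((convex_stdSimplex ℝ (α × β)).isPreconnected).image _ continuous_entPoint.continuousOn)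
    ((∑ a, LinearMap.proj a) ∘ₗ LinearMap.fst ℝ (α × β → ℝ) (ℝ × ℝ × ℝ))
    (by rintro _ ⟨r, hr, rfl⟩; simpa [entPoint] using hr.2) (by omega) hv
  choose r hr hry using hy
  refine ⟨k, by omega, w, r, hw, hr, ?_⟩
  simp only [hry, h]

/-- With a bounded number of points, the hull is a finite union of continuous images of products of
simplices. -/
theorem isCompact_entHull [Nonempty (α × β)] : IsCompact (entHull α β) := by
  have : entHull α β = ⋃ k ∈ Set.Iic (Fintype.card α * Fintype.card β + 2),
      (fun x : (Fin k → ℝ) × (Fin k → α × β → ℝ) => ∑ i, x.1 i • entPoint (x.2 i)) ''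
        (stdSimplex ℝ (Fin k) ×ˢ Set.univ.pi fun _ => stdSimplex ℝ (α × β)) := by
    ext v
    simp only [Set.mem_iUnion, Set.mem_image, Set.mem_prod, Set.mem_univ_pi, Prod.exists]
    constructor
    · intro hv
      obtain ⟨k, hk, w, r, hw, hr, h⟩ := exists_combination_of_mem_entHull hv
      exact ⟨k, hk, w, r, ⟨hw, hr⟩, h⟩
    · rintro ⟨k, -, w, r, ⟨hw, hr⟩, rfl⟩
      exact (convex_convexHull ℝ _).sum_mem (fun i _ => hw.1 i) hw.2 fun i _ =>
        subset_convexHull ℝ _ ⟨_, hr i, rfl⟩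
  rw [this]
  refine (Set.finite_Iic _).isCompact_biUnion fun k _ => ?_
  refine ((isCompact_stdSimplex ℝ (Fin k)).prod
    (isCompact_univ_pi fun _ => isCompact_stdSimplex ℝ (α × β))).image ?_
  refine continuous_finsetSum _ fun i _ => ?_
  exact ((continuous_apply i).comp continuous_fst).smul
    (continuous_entPoint.comp ((continuous_apply i).comp continuous_snd))

/-- The rate tuples admitting a point of the entropy hull that satisfies the rate inequalities. -/
def hullRegion (p : α × β → ℝ) : Set (Fin 5 → ℝ) :=
  {R | ∃ v ∈ entHull α β, v.1 = p ∧ ent p (fun a => a) - v.2.1 ≤ R 0 ∧ v.2.2.1 ≤ R 1 ∧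
    v.2.2.2 ≤ R 2 ∧ v.2.1 - v.2.2.2 ≤ R 3 ∧ v.2.1 - v.2.2.1 ≤ R 4}

theorem isClosed_hullRegion [Nonempty (α × β)] (p : α × β → ℝ) : IsClosed (hullRegion p) := by
  let C : Set (((α × β → ℝ) × ℝ × ℝ × ℝ) × (Fin 5 → ℝ)) :=
    {x | x.1.1 = p ∧ ent p (fun a => a) - x.1.2.1 ≤ x.2 0 ∧ x.1.2.2.1 ≤ x.2 1 ∧
      x.1.2.2.2 ≤ x.2 2 ∧ x.1.2.1 - x.1.2.2.2 ≤ x.2 3 ∧ x.1.2.1 - x.1.2.2.1 ≤ x.2 4}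
  have hC : IsClosed C := by
    simp only [C, Set.ofPred_and]
    refine (isClosed_eq (by fun_prop) (by fun_prop)).inter
      ((isClosed_le (by fun_prop) (by fun_prop)).inter
      ((isClosed_le (by fun_prop) (by fun_prop)).inter
      ((isClosed_le (by fun_prop) (by fun_prop)).inter
      ((isClosed_le (by fun_prop) (by fun_prop)).inter
      (isClosed_le (by fun_prop) (by fun_prop))))))
  have := isCompact_iff_compactSpace.1 (isCompact_entHull (α := α) (β := β))
  have hpre : IsClosed
      {x : ↥(entHull α β) × (Fin 5 → ℝ) | ((x.1 : (α × β → ℝ) × ℝ × ℝ × ℝ), x.2) ∈ C} :=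
    hC.preimage (by fun_prop)
  convert isClosedMap_snd_of_compactSpace _ hpre using 1
  ext R
  constructor
  · rintro ⟨v, hv, h⟩
    exact ⟨(⟨v, hv⟩, R), h, rfl⟩
  · rintro ⟨⟨⟨v, hv⟩, R'⟩, h, rfl⟩
    exact ⟨v, hv, h⟩

end Hull

/-! ### Converse -/

section Converse

variable {α β : Type*} [Fintype α] [Fintype β]

/-- The rate tuples of the single-letter characterization. -/
def singleLetterRegion (p : α × β → ℝ) : Set (Fin 5 → ℝ) :=
  {R : Fin 5 → ℝ |
    ∃ k : ℕ, k ≤ Fintype.card α * Fintype.card β + 2 ∧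
    ∃ W : α → β → Fin k → ℝ, (∀ x y, W x y ∈ stdSimplex ℝ (Fin k)) ∧
      let q : α × β × Fin k → ℝ := joint p W
      let X : α × β × Fin k → α := fun ω => ω.1
      let Y : α × β × Fin k → β := fun ω => ω.2.1
      let U : α × β × Fin k → Fin k := fun ω => ω.2.2
      mutualInfo q (fun ω => (X ω, Y ω)) U ≤ R 0 ∧
      condEntropy q X U ≤ R 1 ∧
      condEntropy q Y U ≤ R 2 ∧
      condEntropy q X (fun ω => (Y ω, U ω)) ≤ R 3 ∧
      condEntropy q Y (fun ω => (X ω, U ω)) ≤ R 4}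

theorem condEntropy_eq_sum_mul_ent {Ω T A B : Type*} [Fintype Ω] [Fintype T] [Fintype A]
    [Fintype B] {q : Ω → ℝ} (hq : ∀ ω, 0 ≤ q ω) (Z : Ω → A) (V : Ω → T) {w : T → ℝ}
    {r : T → A → ℝ} (hV : ∀ t, law q V t = w t)
    (hZV : ∀ a t, law q (fun ω => (Z ω, V ω)) (a, t) = w t * r t a) (f : A → B) :
    condEntropy q (fun ω => f (Z ω)) V = ∑ t, w t * ent (r t) f := by
  rw [← sum_law_mul_ent_condLaw hq]
  refine Finset.sum_congr rfl fun t _ => ?_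
  rw [hV]
  by_cases ht : w t = 0
  · simp [ht]
  · congr 2
    ext a
    rw [condLaw, hZV, hV, mul_div_cancel_left₀ _ ht]

/-- The weights of a short convex combination serve as the law of `U` and its points as the laws of
`(X, Y)` given `U`; Bayes' rule recovers the channel. -/
theorem hullRegion_subset_singleLetterRegion {p : α × β → ℝ} (hp : p ∈ stdSimplex ℝ (α × β)) :
    hullRegion p ⊆ singleLetterRegion p := by
  classical
  have hne : Nonempty (α × β) := nonempty_of_mem_stdSimplex hp
  rintro R ⟨v, hv, hvp, h0, h1, h2, h3, h4⟩
  obtain ⟨k, hk, w, r, hw, hr, hsum⟩ := exists_combination_of_mem_entHull hv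
  have hsum1 : ∀ a, ∑ j, w j * r j a = p a := fun a => by
    have := congr_fun (congr_arg Prod.fst hsum) a
    rw [← hvp, ← this]
    simp [Prod.fst_sum, entPoint]
  have hterm : ∀ a j, 0 ≤ w j * r j a := fun a j => mul_nonneg (hw.1 j) ((hr j).1 a)
  -- Where `p` vanishes Bayes' rule is void; the default `w` keeps every row a probability vector
  -- and does not affect the joint law.
  let W : α → β → Fin k → ℝ := fun x y j =>
    if p (x, y) = 0 then w j else w j * r j (x, y) / p (x, y)
  have hW : ∀ x y, W x y ∈ stdSimplex ℝ (Fin k) := by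
    intro x y
    by_cases h : p (x, y) = 0
    · simpa [W, h] using hw
    · refine ⟨fun j => ?_, ?_⟩
      · simp only [W, h, if_false]
        exact div_nonneg (hterm _ _) (hp.1 _)
      · simp only [W, h, if_false]
        rw [← Finset.sum_div, hsum1, div_self h]
  have hq : ∀ x y j, joint p W (x, y, j) = w j * r j (x, y) := by
    intro x y j
    by_cases h : p (x, y) = 0
    · have := hsum1 (x, y)
      rw [h, Finset.sum_eq_zero_iff_of_nonneg fun j _ => hterm _ _] at this
      simp [joint, h, this j]
    · simp only [joint, W, h, if_false]
      rw [mul_div_cancel₀ _ h]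
  set q := joint p W with hqdef
  have hq0 : ∀ ω, 0 ≤ q ω := fun ω => by rw [hq ω.1 ω.2.1 ω.2.2]; exact hterm _ _
  let Z : α × β × Fin k → α × β := fun ω => (ω.1, ω.2.1)
  let U : α × β × Fin k → Fin k := fun ω => ω.2.2
  have hZU : ∀ a j, law q (fun ω => (Z ω, U ω)) (a, j) = w j * r j a := by
    intro a j
    rw [law_eq_sum_ite, Finset.sum_eq_single (a.1, a.2, j)]
    · simp [Z, U, hq]
    · rintro ⟨x, y, j'⟩ _ hb
      refine if_neg fun h => hb ?_
      obtain ⟨rfl, rfl⟩ := Prod.mk.inj h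
      rfl
    · simp
  have hU : ∀ j, law q U j = w j := fun j => by
    rw [← sum_law_pair_right q Z U j]
    simp only [hZU]
    rw [← Finset.mul_sum, (hr j).2, mul_one]
  have hZ : law q Z = p := by
    ext a
    rw [← sum_law_pair_left q Z U a]
    simp only [hZU, hsum1]
  have e1 : condEntropy q Z U = v.2.1 := by
    rw [condEntropy_eq_sum_mul_ent hq0 Z U hU hZU fun a => a, ← hsum]
    simp [Prod.snd_sum, Prod.fst_sum, entPoint]
  have e2 : condEntropy q (fun ω => (Z ω).1) U = v.2.2.1 := by
    rw [condEntropy_eq_sum_mul_ent hq0 Z U hU hZU Prod.fst, ← hsum]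
    simp [Prod.snd_sum, Prod.fst_sum, entPoint]
  have e3 : condEntropy q (fun ω => (Z ω).2) U = v.2.2.2 := by
    rw [condEntropy_eq_sum_mul_ent hq0 Z U hU hZU Prod.snd, ← hsum]
    simp [Prod.snd_sum, entPoint]
  have e0 : ent q Z = ent p fun a => a := by rw [← hZ, ent_law]
  have e1' := condEntropy_eq hq0 Z U
  have e2' := condEntropy_eq hq0 (fun ω => (Z ω).1) U
  have e3' := condEntropy_eq hq0 (fun ω => (Z ω).2) U
  refine ⟨k, hk, W, hW, ?_, e2.trans_le h1, e3.trans_le h2, ?_, ?_⟩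
  · refine (mutualInfo_eq hq0 Z U).trans_le ?_
    linarith
  · refine (condEntropy_eq hq0 _ _).trans_le ?_
    have : ent q (fun ω => (ω.1, ω.2.1, ω.2.2)) = ent q (fun ω => (Z ω, U ω)) :=
      ent_congr fun ω ω' => by simp [Z, U, Prod.ext_iff, and_assoc]
    refine le_trans (le_of_eq ?_) h3
    rw [this, ← e1, ← e3, e1', e3', sub_sub_sub_cancel_right]
  · refine (condEntropy_eq hq0 _ _).trans_le ?_
    have : ent q (fun ω => (ω.2.1, ω.1, ω.2.2)) = ent q (fun ω => (Z ω, U ω)) :=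
      ent_congr fun ω ω' => by simp only [Z, U, Prod.mk.injEq]; tauto
    refine le_trans (le_of_eq ?_) h4
    rw [this, ← e1, ← e2, e1', e2', sub_sub_sub_cancel_right]

theorem logb_numMessages_le {n : ℕ} {r : ℝ} (h : 0 < numMessages n r) :
    Real.logb 2 (numMessages n r) ≤ n * r := by
  rw [Real.logb_le_iff_le_rpow (by norm_num) (by exact_mod_cast h)]
  exact Nat.floor_le (by positivity)

theorem prob_le_errorProb {p : α × β → ℝ} (hp : ∀ a, 0 ≤ p a) {n : ℕ} {R : Fin 5 → ℝ}
    (c : Code α β n R) {E : Set (Fin n → α × β)}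
    (hE : ∀ z, c.Correct (fun i => (z i).1) (fun i => (z i).2) → z ∉ E) :
    prob (iid p n) E ≤ errorProb p c :=
  prob_mono (iid_nonneg hp n) fun z _ hz h => hE z h hz

/-- A code of positive block length puts its rates, up to Fano's slack, into the hull region. -/
theorem add_mem_hullRegion_of_code {p : α × β → ℝ} (hp : p ∈ stdSimplex ℝ (α × β)) {n : ℕ}
    (hn : 0 < n) {R : Fin 5 → ℝ} (c : Code α β n R) {δ η : ℝ} (hδ : 0 < δ) (hδ1 : δ < 1)
    (hη : 0 ≤ η)
    (hα : -Real.logb 2 (1 - δ) + errorProb p c * Real.logb 2 (Fintype.card α / δ) ≤ η)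
    (hβ : -Real.logb 2 (1 - δ) + errorProb p c * Real.logb 2 (Fintype.card β / δ) ≤ η) :
    (fun k => R k + η) ∈ hullRegion p := by
  classical
  have hn' : (0 : ℝ) < n := by exact_mod_cast hn
  have hq := iid_mem_stdSimplex hp n
  set q := iid p n with hqdef
  obtain ⟨z₀⟩ := nonempty_of_mem_stdSimplex hq
  let m : (k : Fin 5) → (Fin n → α × β) → Fin (numMessages n (R k)) :=
    fun k z => c.enc (fun i => (z i).1) (fun i => (z i).2) k
  have hcard : ∀ k, Real.logb 2 (Fintype.card (Fin (numMessages n (R k)))) ≤ n * R k := fun k => by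
    rw [Fintype.card_fin]
    exact logb_numMessages_le (m k z₀).pos
  -- The auxiliary variable at time `i`: the common message and both source pasts.
  let V : (i : Fin n) → (Fin n → α × β) → _ := fun i => hist (m 0) i
  let v : Fin n → (α × β → ℝ) × ℝ × ℝ × ℝ := fun i =>
    (law q (fun z => z i), condEntropy q (fun z => z i) (V i),
      condEntropy q (fun z => (z i).1) (V i), condEntropy q (fun z => (z i).2) (V i))
  have hv : ∀ i, v i ∈ entHull α β := fun i => condEntropy_mem_entHull hq _ _
  have hmem : ∑ i, (n : ℝ)⁻¹ • v i ∈ entHull α β :=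
    (convex_convexHull ℝ _).sum_mem (fun i _ => by positivity) (by simp [hn'.ne'])
      fun i _ => hv i
  have hv1 : ∀ i, (v i).2.1 = ent q (fun z => (z i, V i z)) - ent q (V i) :=
    fun i => condEntropy_eq hq.1 _ _
  have hv2 : ∀ i, (v i).2.2.1 = ent q (fun z => ((z i).1, V i z)) - ent q (V i) :=
    fun i => condEntropy_eq hq.1 _ _
  have hv3 : ∀ i, (v i).2.2.2 = ent q (fun z => ((z i).2, V i z)) - ent q (V i) :=
    fun i => condEntropy_eq hq.1 _ _
  have b0 : n * ent p (fun a => a) - ∑ i, (v i).2.1 ≤ n * R 0 := by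
    have h := sum_ent_hist q (m 0)
    simp only [hv1]
    rw [ent_iid hp n] at h
    have := (ent_le_logb_card hq (m 0)).trans (hcard 0)
    linarith
  have b1 : ∑ i, (v i).2.2.1 ≤ n * R 1 + n * η := by
    have h := sum_ent_hist_le_of_decoder hq (m 0) (m 1) Prod.fst (fun _ => ())
      (fun i t => c.dec₁ t.2.2.1 t.1 i) (fun i => prob_le_errorProb hp.1 c
        fun z hz => by simpa [hist, m] using congr_fun hz.1 i) hδ hδ1
    have h' := (h.trans (add_le_add (hcard 1) (mul_le_mul_of_nonneg_left hα hn'.le)))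
    refine (Finset.sum_congr rfl fun i _ => ?_).trans_le h'
    rw [hv2]
    congr 1 <;> exact ent_congr fun z z' => by simp [V]
  have b2 : ∑ i, (v i).2.2.2 ≤ n * R 2 + n * η := by
    have h := sum_ent_hist_le_of_decoder hq (m 0) (m 2) Prod.snd (fun _ => ())
      (fun i t => c.dec₂ t.2.2.1 t.1 i) (fun i => prob_le_errorProb hp.1 c
        fun z hz => by simpa [hist, m] using congr_fun hz.2.1 i) hδ hδ1
    have h' := (h.trans (add_le_add (hcard 2) (mul_le_mul_of_nonneg_left hβ hn'.le)))
    refine (Finset.sum_congr rfl fun i _ => ?_).trans_le h'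
    rw [hv3]
    congr 1 <;> exact ent_congr fun z z' => by simp [V]
  have b3 : ∑ i, ((v i).2.1 - (v i).2.2.2) ≤ n * R 3 + n * η := by
    have h := sum_ent_hist_le_of_decoder hq (m 0) (m 3) Prod.fst Prod.snd
      -- The side information up to time `i` is reassembled from the history for `j < i` and from `σ
      -- (z i)` for `j = i`.
      (fun i t => c.dec₃ i t.2.2.1 t.1 fun j =>
        if hj : j.1.val < i.val then (t.2.2.2 ⟨j.1, hj⟩).2 else t.2.1)
      (fun i => prob_le_errorProb hp.1 c fun z hz => by
        have h1 := hz.2.2.1 i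
        simp only [Set.mem_ofPred_eq, not_not, hist, ne_eq]
        refine Eq.trans ?_ h1
        congr 1
        ext j
        split_ifs with hj
        · rfl
        · rw [show j.1 = i from le_antisymm j.2 (not_lt.1 hj)]) hδ hδ1
    have h' := (h.trans (add_le_add (hcard 3) (mul_le_mul_of_nonneg_left hα hn'.le)))
    refine (Finset.sum_congr rfl fun i _ => ?_).trans_le h'
    rw [hv1, hv3, sub_sub_sub_cancel_right]
    congr 1
    exact ent_congr fun z z' => by simp [V, Prod.ext_iff, and_assoc]
  have b4 : ∑ i, ((v i).2.1 - (v i).2.2.1) ≤ n * R 4 + n * η := by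
    have h := sum_ent_hist_le_of_decoder hq (m 0) (m 4) Prod.snd Prod.fst
      (fun i t => c.dec₄ i t.2.2.1 t.1 fun j =>
        if hj : j.1.val < i.val then (t.2.2.2 ⟨j.1, hj⟩).1 else t.2.1)
      (fun i => prob_le_errorProb hp.1 c fun z hz => by
        have h1 := hz.2.2.2 i
        simp only [Set.mem_ofPred_eq, not_not, hist, ne_eq]
        refine Eq.trans ?_ h1
        congr 1
        ext j
        split_ifs with hj
        · rfl
        · rw [show j.1 = i from le_antisymm j.2 (not_lt.1 hj)]) hδ hδ1
    have h' := (h.trans (add_le_add (hcard 4) (mul_le_mul_of_nonneg_left hβ hn'.le)))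
    refine (Finset.sum_congr rfl fun i _ => ?_).trans_le h'
    rw [hv1, hv2, sub_sub_sub_cancel_right]
    congr 1
    exact ent_congr fun z z' => by simp [V, Prod.ext_iff]; tauto
  have hscale : ∀ {a b : ℝ}, a ≤ n * b → (n : ℝ)⁻¹ * a ≤ b := fun h => by
    rwa [inv_mul_le_iff₀ hn']
  rw [Finset.sum_sub_distrib] at b3 b4
  have c0 := hscale b0
  have c1 := hscale (b1.trans_eq (mul_add _ _ _).symm)
  have c2 := hscale (b2.trans_eq (mul_add _ _ _).symm)
  have c3 := hscale (b3.trans_eq (mul_add _ _ _).symm)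
  have c4 := hscale (b4.trans_eq (mul_add _ _ _).symm)
  rw [mul_sub, ← mul_assoc, inv_mul_cancel₀ hn'.ne', one_mul] at c0
  rw [mul_sub] at c3 c4
  rw [← Finset.smul_sum] at hmem
  refine ⟨_, hmem, ?_, ?_, ?_, ?_, ?_, ?_⟩
  · simp only [Prod.smul_fst, Prod.fst_sum, v, hqdef, law_iid_apply hp]
    ext a
    simp [hn'.ne']
  all_goals simp only [Prod.smul_fst, Prod.smul_snd, Prod.fst_sum, Prod.snd_sum, smul_eq_mul]
  all_goals linarith

theorem tendsto_add_pi_nhdsGT {ι : Type*} (R : ι → ℝ) :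
    Tendsto (fun (η : ℝ) (k : ι) => R k + η) (𝓝[>] 0) (𝓝 R) := by
  rw [tendsto_pi_nhds]
  intro k
  have : Tendsto (fun η : ℝ => R k + η) (𝓝 0) (𝓝 (R k + 0)) := tendsto_id.const_add _
  rw [add_zero] at this
  exact this.mono_left nhdsWithin_le_nhds

theorem rateRegion_subset_hullRegion {p : α × β → ℝ} (hp : p ∈ stdSimplex ℝ (α × β)) :
    rateRegion p ⊆ hullRegion p := by
  have hne : Nonempty (α × β) := nonempty_of_mem_stdSimplex hp
  refine closure_minimal ?_ (isClosed_hullRegion p)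
  rintro R ⟨c, hc⟩
  have hη : ∀ η : ℝ, 0 < η → (fun k => R k + η) ∈ hullRegion p := by
    intro η hη
    -- This makes `-log (1 - δ)` equal to `η / 2`. With `δ` fixed, the vanishing error probability
    -- brings the other Fano term below `η / 2`.
    set δ : ℝ := 1 - 2 ^ (-(η / 2)) with hδ
    have h2 : (2 : ℝ) ^ (-(η / 2)) < 1 :=
      Real.rpow_lt_one_of_one_lt_of_neg (by norm_num) (by linarith)
    have h2' : (0 : ℝ) < 2 ^ (-(η / 2)) := by positivity
    have hlog : -Real.logb 2 (1 - δ) = η / 2 := by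
      rw [hδ, sub_sub_cancel, Real.logb_rpow (by norm_num) (by norm_num), neg_neg]
    have hev : ∀ L : ℝ, ∀ᶠ n in atTop, errorProb p (c n) * L < η / 2 := fun L => by
      have := hc.mul_const L
      rw [zero_mul] at this
      exact this.eventually_lt_const (by linarith)
    obtain ⟨n, h1, h3, hn⟩ := ((hev (Real.logb 2 (Fintype.card α / δ))).and
      ((hev (Real.logb 2 (Fintype.card β / δ))).and (eventually_gt_atTop 0))).exists
    exact add_mem_hullRegion_of_code (δ := δ) hp hn (c n) (by linarith) (by linarith) hη.le
      (by rw [hlog]; linarith) (by rw [hlog]; linarith)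
  exact (isClosed_hullRegion p).mem_of_tendsto (tendsto_add_pi_nhdsGT R)
    (eventually_nhdsWithin_of_forall fun η h => hη η h)

end Converse

/-! ### Greedy covering and dictionaries -/

section Covering

variable {D B : Type*} [Fintype D] [Fintype B]

theorem exists_le_of_sum_mul_le {w : D → ℝ} (hw : w ∈ stdSimplex ℝ D) {F : D → ℝ} {c : ℝ}
    (h : ∑ d, w d * F d ≤ c) : ∃ d, F d ≤ c := by
  by_contra! hc
  obtain ⟨d, hd⟩ : ∃ d, 0 < w d := by
    by_contra! h0
    have := Finset.sum_nonpos fun d (_ : d ∈ Finset.univ) => h0 d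
    rw [hw.2] at this
    linarith
  have : ∑ d, w d * c < ∑ d, w d * F d :=
    Finset.sum_lt_sum (fun d _ => mul_le_mul_of_nonneg_left (hc d).le (hw.1 d))
      ⟨d, Finset.mem_univ d, mul_lt_mul_of_pos_left (hc d) hd⟩
  rw [← Finset.sum_mul, hw.2, one_mul] at this
  linarith

theorem prob_compl {w : D → ℝ} (hw : w ∈ stdSimplex ℝ D) (E : Set D) :
    prob w Eᶜ = 1 - prob w E := by
  classical
  rw [eq_sub_iff_add_eq, ← hw.2]
  simp only [prob_eq_sum_ite, ← Finset.sum_add_distrib]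
  refine Finset.sum_congr rfl fun d _ => ?_
  by_cases h : d ∈ E <;> simp [h]

/-- Greedy covering: if a random `d` covers every `b ∈ G` with probability at least `θ`, then
some `M` elements leave at most a fraction `(1 - θ) ^ M` of the mass of `G` uncovered. -/
theorem exists_covering {w : D → ℝ} (hw : w ∈ stdSimplex ℝ D) {μ : B → ℝ} (hμ : ∀ b, 0 ≤ μ b)
    (C : D → B → Prop) (G : Set B) {θ : ℝ} (hθ1 : θ ≤ 1)
    (h : ∀ b ∈ G, θ ≤ prob w {d | C d b}) (M : ℕ) :
    ∃ d : Fin M → D, prob μ {b | b ∈ G ∧ ∀ m, ¬ C (d m) b} ≤ (1 - θ) ^ M * ∑ b, μ b := by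
  classical
  induction M with
  | zero =>
    refine ⟨Fin.elim0, ?_⟩
    rw [pow_zero, one_mul]
    exact Finset.sum_le_sum fun b _ => Set.indicator_le_self' (fun _ _ => hμ _) b
  | succ M ih =>
    obtain ⟨d, hd⟩ := ih
    set E := {b | b ∈ G ∧ ∀ m, ¬ C (d m) b} with hE
    -- A random further element misses each uncovered point with probability at most `1 - θ`; some
    -- element does at least as well as the average.
    have havg : ∑ d', w d' * prob μ {b | b ∈ E ∧ ¬ C d' b} ≤ (1 - θ) * prob μ E := by
      simp only [prob_eq_sum_ite, Finset.mul_sum]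
      rw [Finset.sum_comm]
      refine Finset.sum_le_sum fun b _ => ?_
      by_cases hb : b ∈ E
      · have h1 : ∑ d', w d' * (if b ∈ {b | b ∈ E ∧ ¬ C d' b} then μ b else 0) =
            prob w {d' | C d' b}ᶜ * μ b := by
          rw [prob_eq_sum_ite, Finset.sum_mul]
          refine Finset.sum_congr rfl fun d' _ => ?_
          by_cases hc : C d' b <;> simp [hc, hb]
        rw [h1, if_pos hb, prob_compl hw]
        exact mul_le_mul_of_nonneg_right (by linarith [h b hb.1]) (hμ b)
      · simp [hb]
    obtain ⟨d', hd'⟩ := exists_le_of_sum_mul_le hw havg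
    refine ⟨Fin.cons d' d, ?_⟩
    have hset : {b | b ∈ G ∧ ∀ m, ¬ C ((Fin.cons d' d : Fin (M + 1) → D) m) b} =
        {b | b ∈ E ∧ ¬ C d' b} := by
      ext b
      simp only [Set.mem_ofPred_eq, Fin.forall_fin_succ, Fin.cons_zero, Fin.cons_succ, hE]
      tauto
    rw [hset, pow_succ, mul_comm ((1 - θ) ^ M), mul_assoc]
    exact hd'.trans (mul_le_mul_of_nonneg_left hd (by linarith))

/-- A dictionary of letterwise maps such that every sufficiently likely sequence is reproduced by
one of them from the side information. -/
theorem exists_dictionary {S A : Type*} [Fintype S] [Fintype A] {κ : S → A → ℝ}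
    (hκ : ∀ s, κ s ∈ stdSimplex ℝ A) {n M : ℕ} {θ : ℝ} (hθ1 : θ ≤ 1)
    (h : (1 - θ) ^ M * ((Fintype.card A * Fintype.card S : ℕ) : ℝ) ^ n < 1) :
    ∃ D : Fin M → Fin n → S → A, ∀ (a : Fin n → A) (s : Fin n → S),
      θ ≤ ∏ i, κ (s i) (a i) → ∃ m, ∀ i, D m i (s i) = a i := by
  classical
  -- A random dictionary entry draws all its values independently, the value at `(i, s)` from `κ s`.
  -- Only the values at `(i, s i)` matter for a given pair of sequences, so it succeeds with
  -- probability `∏ κ (s i) (a i)`.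
  let w : (Fin n × S → A) → ℝ := fun d => ∏ x, κ x.2 (d x)
  have hw : w ∈ stdSimplex ℝ (Fin n × S → A) := by
    refine ⟨fun d => Finset.prod_nonneg fun x _ => (hκ _).1 _, ?_⟩
    simp only [w]
    rw [sum_prod_pi fun (x : Fin n × S) a => κ x.2 a]
    simp [(hκ _).2]
  have hC : ∀ (a : Fin n → A) (s : Fin n → S),
      prob w {d | ∀ i, d (i, s i) = a i} = ∏ i, κ (s i) (a i) := by
    intro a s
    have h1 := sum_prod_pi fun (x : Fin n × S) b =>
      κ x.2 b * if x.2 = s x.1 → b = a x.1 then 1 else 0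
    rw [prob_eq_sum_ite]
    have h2 : ∀ x : Fin n × S, (∑ b, κ x.2 b * if x.2 = s x.1 → b = a x.1 then 1 else 0) =
        if x.2 = s x.1 then κ (s x.1) (a x.1) else 1 := by
      intro x
      by_cases hx : x.2 = s x.1
      · simp [hx]
      · simp [hx, (hκ _).2]
    simp only [h2] at h1
    rw [Fintype.prod_prod_type] at h1
    simp only [Finset.prod_ite_eq', Finset.mem_univ, if_true] at h1
    rw [← h1]
    refine Finset.sum_congr rfl fun d _ => ?_
    rw [Finset.prod_mul_distrib]
    have hind : (∏ x : Fin n × S, if x.2 = s x.1 → d x = a x.1 then (1 : ℝ) else 0) =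
        if ∀ i, d (i, s i) = a i then 1 else 0 := by
      rw [Finset.prod_ite_zero, Finset.prod_const_one]
      congr 1
      simp only [Finset.mem_univ, true_imp_iff, Prod.forall, eq_iff_iff]
      exact ⟨fun h i => h i _ rfl, fun h i t ht => by rw [show t = s i from ht, h]⟩
    rw [hind, mul_ite, mul_one, mul_zero]
    rfl
  -- With counting measure on all pairs of sequences, fewer than one pair remains uncovered, hence
  -- none.
  obtain ⟨d, hd⟩ := exists_covering (μ := fun _ => (1 : ℝ)) hw (fun _ => zero_le_one)
    (fun d (b : (Fin n → A) × (Fin n → S)) => ∀ i, d (i, b.2 i) = b.1 i)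
    {b | θ ≤ ∏ i, κ (b.2 i) (b.1 i)} hθ1 (fun b hb => by rw [hC]; exact hb) M
  refine ⟨fun m i s => d m (i, s), fun a s has => ?_⟩
  by_contra hcon
  have h1 : (1 : ℝ) ≤ prob (fun _ : (Fin n → A) × (Fin n → S) => (1 : ℝ))
      {b | b ∈ {b : (Fin n → A) × (Fin n → S) | θ ≤ ∏ i, κ (b.2 i) (b.1 i)} ∧
        ∀ m, ¬ ∀ i, d m (i, b.2 i) = b.1 i} := by
    rw [prob_eq_sum_ite]
    refine le_trans ?_ (Finset.single_le_sum (fun b _ => ?_) (Finset.mem_univ (a, s)))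
    · rw [if_pos ⟨has, fun m hm => hcon ⟨m, hm⟩⟩]
    · split_ifs <;> norm_num
  have h2 : ∑ _b : (Fin n → A) × (Fin n → S), (1 : ℝ) =
      ((Fintype.card A * Fintype.card S : ℕ) : ℝ) ^ n := by
    simp [mul_pow]
  rw [h2] at hd
  linarith

end Covering

/-! ### Chernoff bound -/

section LargeDeviations

variable {A : Type*} [Fintype A]

/-- Weak law of large numbers in one-sided form, by Chernoff's bound. -/
theorem tendsto_prob_iid_sum_nonneg {p : A → ℝ} (hp : p ∈ stdSimplex ℝ A) {g : A → ℝ}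
    (hg : ∑ a, p a * g a < 0) :
    Tendsto (fun n => prob (iid p n) {z | 0 ≤ ∑ i, g (z i)}) atTop (𝓝 0) := by
  classical
  set μ := ∑ a, p a * g a with hμ
  obtain ⟨K, hK0, hK⟩ : ∃ K : ℝ, 0 < K ∧ ∀ a, |g a| ≤ K := by
    refine ⟨1 + ∑ a, |g a|, by positivity, fun a => ?_⟩
    have := Finset.single_le_sum (fun a _ => abs_nonneg (g a)) (Finset.mem_univ a)
    linarith
  -- The first bound gives `|t g| ≤ 1`, as the quadratic estimate of `exp` requires; the second
  -- makes the error `t² K²` at most half of `-t μ`, so the exponential moment is below one.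
  set t := min K⁻¹ (-μ / (2 * K ^ 2)) with ht
  have ht0 : 0 < t := lt_min (by positivity) (div_pos (by linarith) (by positivity))
  have hexp : ∀ a, Real.exp (t * g a) ≤ 1 + t * g a + t ^ 2 * K ^ 2 := by
    intro a
    have h1 : |t * g a| ≤ 1 := by
      rw [abs_mul, abs_of_pos ht0]
      calc t * |g a| ≤ K⁻¹ * K := mul_le_mul (min_le_left _ _) (hK a) (abs_nonneg _) (by positivity)
        _ = 1 := inv_mul_cancel₀ hK0.ne'
    have h2 := (abs_le.1 (Real.abs_exp_sub_one_sub_id_le h1)).2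
    have h3 : (t * g a) ^ 2 ≤ t ^ 2 * K ^ 2 := by
      rw [mul_pow]
      exact mul_le_mul_of_nonneg_left (sq_le_sq' (abs_le.1 (hK a)).1 (abs_le.1 (hK a)).2)
        (sq_nonneg t)
    linarith
  set ρ := ∑ a, p a * Real.exp (t * g a) with hρ
  have hρ0 : 0 ≤ ρ := Finset.sum_nonneg fun a _ => mul_nonneg (hp.1 a) (Real.exp_pos _).le
  have hρ1 : ρ < 1 := by
    have h1 : ρ ≤ 1 + t * μ + t ^ 2 * K ^ 2 := by
      calc ρ ≤ ∑ a, p a * (1 + t * g a + t ^ 2 * K ^ 2) :=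
            Finset.sum_le_sum fun a _ => mul_le_mul_of_nonneg_left (hexp a) (hp.1 a)
        _ = (∑ a, p a) * (1 + t ^ 2 * K ^ 2) + t * ∑ a, p a * g a := by
            rw [Finset.sum_mul, Finset.mul_sum, ← Finset.sum_add_distrib]
            exact Finset.sum_congr rfl fun a _ => by ring
        _ = 1 + t * μ + t ^ 2 * K ^ 2 := by rw [hp.2]; ring
    have h2 : t * (2 * K ^ 2) ≤ -μ := (le_div_iff₀ (by positivity)).1 (min_le_right _ _)
    have h3 := mul_le_mul_of_nonneg_left h2 ht0.le
    have h4 : t * μ < 0 := mul_neg_of_pos_of_neg ht0 hg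
    nlinarith
  have hbound : ∀ n, prob (iid p n) {z | 0 ≤ ∑ i, g (z i)} ≤ ρ ^ n := by
    intro n
    have h1 : ρ ^ n = ∑ z : Fin n → A, iid p n z * Real.exp (t * ∑ i, g (z i)) := by
      have := sum_prod_pi fun (_ : Fin n) a => p a * Real.exp (t * g a)
      rw [Finset.prod_const, Finset.card_univ, Fintype.card_fin] at this
      rw [hρ, ← this]
      refine Finset.sum_congr rfl fun z _ => ?_
      rw [Finset.prod_mul_distrib, Finset.mul_sum, Real.exp_sum, iid]
    rw [h1, prob_eq_sum_ite]
    refine Finset.sum_le_sum fun z _ => ?_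
    have h0 := iid_nonneg hp.1 n z
    split_ifs with hz
    · exact le_mul_of_one_le_right h0 (Real.one_le_exp (mul_nonneg ht0.le hz))
    · exact mul_nonneg h0 (Real.exp_pos _).le
  exact squeeze_zero (fun n => prob_nonneg (iid_nonneg hp.1 n) _) hbound
    (tendsto_pow_atTop_nhds_zero_of_lt_one hρ0 hρ1)

end LargeDeviations

/-! ### Doubly exponential decay -/

section Asymptotics

theorem half_rpow_le_numMessages {n : ℕ} {r : ℝ} (hr : 0 ≤ r) :
    (2 : ℝ) ^ (n * r) / 2 ≤ numMessages n r := by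
  have h1 : (1 : ℝ) ≤ 2 ^ (n * r) := Real.one_le_rpow (by norm_num) (by positivity)
  have h2 : (1 : ℝ) ≤ numMessages n r := by
    exact_mod_cast (Nat.le_floor (by exact_mod_cast h1) : 1 ≤ ⌊(2 : ℝ) ^ (n * r)⌋₊)
  have h3 : (2 : ℝ) ^ (n * r) < numMessages n r + 1 := Nat.lt_floor_add_one _
  linarith

theorem numMessages_pos {n : ℕ} {r : ℝ} (hr : 0 ≤ r) : 0 < numMessages n r := by
  have := half_rpow_le_numMessages (n := n) hr
  have h2 : (0 : ℝ) < 2 ^ (n * r) / 2 := by positivity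
  exact_mod_cast h2.trans_le this

/-- The uncovered fraction vanishes doubly exponentially. -/
theorem tendsto_one_sub_pow_numMessages {c r r' C : ℝ} (hc : 0 < c) (hc1 : c ≤ 1) (hr' : 0 ≤ r')
    (hr : r' < r) (hC : 0 < C) :
    Tendsto (fun n : ℕ => (1 - c * 2 ^ (-(n * r'))) ^ numMessages n r * C ^ n) atTop (𝓝 0) := by
  set b : ℝ := 2 ^ (r - r') with hb
  have hb1 : 1 < b := Real.one_lt_rpow (by norm_num) (by linarith)
  -- The quantity to be bounded is at most `exp (-(c / 2) b^n + n log C)`; the half comes from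
  -- rounding the number of messages down. Since `b > 1`, the term `b^n` wins.
  have hlim : Tendsto (fun n : ℕ => b ^ n * (c / 2 - (n : ℝ) ^ 1 / b ^ n * Real.log C))
      atTop atTop := by
    refine (tendsto_pow_atTop_atTop_of_one_lt hb1).atTop_mul_pos (C := c / 2) (by positivity) ?_
    have := ((tendsto_pow_const_div_const_pow_of_one_lt 1 hb1).mul_const (Real.log C)).const_sub
      (c / 2)
    simpa using this
  refine squeeze_zero (fun n => ?_) (fun n => ?_) (Real.tendsto_exp_neg_atTop_nhds_zero.comp hlim)
  all_goals
    have hθ1 : c * (2 : ℝ) ^ (-(n * r')) ≤ 1 := by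
      have : (2 : ℝ) ^ (-(n * r')) ≤ 1 :=
        Real.rpow_le_one_of_one_le_of_nonpos (by norm_num) (by
          have : 0 ≤ n * r' := by positivity
          linarith)
      have h0 : (0 : ℝ) < 2 ^ (-(n * r')) := by positivity
      nlinarith
  · exact mul_nonneg (pow_nonneg (by linarith) _) (by positivity)
  · have h1 : (1 - c * (2 : ℝ) ^ (-(n * r'))) ^ numMessages n r ≤
        Real.exp (-(c * 2 ^ (-(n * r')) * numMessages n r)) := by
      calc _ ≤ Real.exp (-(c * 2 ^ (-(n * r')))) ^ numMessages n r :=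
            pow_le_pow_left₀ (by linarith) (Real.one_sub_le_exp_neg _) _
        _ = _ := by rw [← Real.exp_nat_mul]; congr 1; ring
    have h2 : c / 2 * b ^ n ≤ c * 2 ^ (-(n * r')) * numMessages n r := by
      have h3 : b ^ n = 2 ^ (-(n * r')) * (2 : ℝ) ^ (n * r) := by
        rw [hb, ← Real.rpow_natCast, ← Real.rpow_mul (by norm_num),
          ← Real.rpow_add (by norm_num)]
        congr 1
        ring
      have h4 : 0 ≤ c * (2 : ℝ) ^ (-(n * r')) := by positivity
      have := mul_le_mul_of_nonneg_left
        (half_rpow_le_numMessages (n := n) (hr'.trans hr.le)) h4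
      rw [h3]
      linarith
    have h3 : C ^ n = Real.exp (n * Real.log C) := by
      rw [Real.exp_nat_mul, Real.exp_log hC]
    have hbn : b ^ n ≠ 0 := by positivity
    calc _ ≤ Real.exp (-(c / 2 * b ^ n)) * Real.exp (n * Real.log C) := by
          rw [h3]
          exact mul_le_mul_of_nonneg_right (h1.trans (Real.exp_le_exp.2 (by linarith)))
            (Real.exp_pos _).le
      _ = _ := by
          rw [← Real.exp_add]
          simp only [Function.comp_apply]
          congr 1
          field_simp
          ring

end Asymptotics

/-! ### Covering by a common codebook -/

section TypicalCovering

variable {Z υ : Type*} [Fintype Z] [Fintype υ]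

/-- Covering lemma: a random codebook contains, for most source sequences `z`, a word `u` such
that `(z, u)` lies in the likely set `T`. -/
theorem exists_typical_covering {p : Z → ℝ} (hp : p ∈ stdSimplex ℝ Z) {W : Z → υ → ℝ}
    (hW : ∀ z, W z ∈ stdSimplex ℝ υ) {π : υ → ℝ} (hπ : π ∈ stdSimplex ℝ υ) {n : ℕ}
    (T : Set ((Fin n → Z) × (Fin n → υ))) {θ : ℝ} (hθ : 0 ≤ θ) (hθ1 : θ ≤ 1)
    (hT : ∀ z u, (z, u) ∈ T → 2 * θ * ∏ i, W (z i) (u i) ≤ ∏ i, π (u i)) (M : ℕ) :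
    ∃ c : Fin M → Fin n → υ, prob (iid p n) {z | ∀ m, (z, c m) ∉ T} ≤ (1 - θ) ^ M +
      2 * prob (iid (fun x : Z × υ => p x.1 * W x.1 x.2) n)
        {ω | ((fun i => (ω i).1), fun i => (ω i).2) ∉ T} := by
  classical
  have hp0 := iid_nonneg hp.1 n
  let K : (Fin n → Z) → (Fin n → υ) → ℝ := fun z u => ∏ i, W (z i) (u i)
  have hK : ∀ z, K z ∈ stdSimplex ℝ (Fin n → υ) := fun z => by
    refine ⟨fun u => Finset.prod_nonneg fun i _ => (hW _).1 _, ?_⟩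
    simp only [K]
    rw [sum_prod_pi fun i u => W (z i) u]
    simp [(hW _).2]
  -- For these `z` the true channel lands in `T` at least half of the time, so the change of measure
  -- `hT` makes a word drawn from `π` land there with probability at least `θ`. By Markov's
  -- inequality the other `z` have at most twice the probability of leaving `T`.
  let G : Set (Fin n → Z) := {z | 1 / 2 ≤ prob (K z) {u | (z, u) ∈ T}}
  have hG : ∀ z ∈ G, θ ≤ prob (iid π n) {u | (z, u) ∈ T} := by
    intro z hz
    have h1 : 2 * θ * prob (K z) {u | (z, u) ∈ T} ≤ prob (iid π n) {u | (z, u) ∈ T} := by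
      rw [prob_eq_sum_ite, prob_eq_sum_ite, Finset.mul_sum]
      refine Finset.sum_le_sum fun u _ => ?_
      by_cases hu : u ∈ {u | (z, u) ∈ T}
      · rw [if_pos hu, if_pos hu]
        exact hT z u hu
      · rw [if_neg hu, if_neg hu, mul_zero]
    have h2 : 2 * θ * (1 / 2) ≤ 2 * θ * prob (K z) {u | (z, u) ∈ T} :=
      mul_le_mul_of_nonneg_left hz (by positivity)
    linarith
  obtain ⟨c, hc⟩ := exists_covering (iid_mem_stdSimplex hπ n) hp0
    (fun u z => (z, u) ∈ T) G hθ1 hG M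
  rw [(iid_mem_stdSimplex hp n).2, mul_one] at hc
  refine ⟨c, ?_⟩
  have hsplit : prob (iid p n) {z | ∀ m, (z, c m) ∉ T} ≤
      prob (iid p n) {z | z ∈ G ∧ ∀ m, (z, c m) ∉ T} + prob (iid p n) Gᶜ :=
    (prob_mono hp0 fun z _ hz => by
      by_cases h : z ∈ G
      · exact Or.inl ⟨h, hz⟩
      · exact Or.inr h).trans (prob_union_le hp0 _ _)
  have hjoint : prob (iid (fun x : Z × υ => p x.1 * W x.1 x.2) n)
      {ω | ((fun i => (ω i).1), fun i => (ω i).2) ∉ T} =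
      ∑ z, iid p n z * prob (K z) {u | (z, u) ∈ T}ᶜ := by
    rw [prob_eq_sum_ite, ← (Equiv.arrowProdEquivProdArrow (Fin n) (fun _ => Z)
      (fun _ => υ)).symm.sum_comp, Fintype.sum_prod_type]
    refine Finset.sum_congr rfl fun z _ => ?_
    rw [prob_eq_sum_ite, Finset.mul_sum]
    refine Finset.sum_congr rfl fun u _ => ?_
    simp [iid, K, Equiv.arrowProdEquivProdArrow, Finset.prod_mul_distrib]
  have hGc : prob (iid p n) Gᶜ ≤ 2 * ∑ z, iid p n z * prob (K z) {u | (z, u) ∈ T}ᶜ := by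
    rw [prob_eq_sum_ite, Finset.mul_sum]
    refine Finset.sum_le_sum fun z _ => ?_
    by_cases hz : z ∈ G
    · rw [if_neg (by simpa using hz)]
      have := mul_nonneg (hp0 z) (prob_nonneg (hK z).1 {u | (z, u) ∈ T}ᶜ)
      linarith
    · rw [if_pos (show z ∈ Gᶜ from hz), prob_compl (hK z)]
      have hz' : prob (K z) {u | (z, u) ∈ T} < 1 / 2 := not_le.1 hz
      have := mul_le_mul_of_nonneg_left hz'.le (hp0 z)
      linarith
  rw [hjoint]
  linarith

theorem rpow_neg_le_prod {ι : Type*} [Fintype ι] {f : ι → ℝ} (hf : ∀ i, 0 < f i) {t : ℝ}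
    (h : ∑ i, -Real.logb 2 (f i) ≤ t) : (2 : ℝ) ^ (-t) ≤ ∏ i, f i := by
  have h1 : ∏ i, f i = (2 : ℝ) ^ ∑ i, Real.logb 2 (f i) := by
    rw [Real.rpow_sum_of_pos (by norm_num)]
    exact Finset.prod_congr rfl fun i _ =>
      (Real.rpow_logb (by norm_num) (by norm_num) (hf i)).symm
  rw [h1]
  refine Real.rpow_le_rpow_of_exponent_le (by norm_num) ?_
  rw [Finset.sum_neg_distrib] at h
  linarith

end TypicalCovering

/-! ### Achievability -/

section Achievability

variable {α β υ : Type*} [Fintype α] [Fintype β]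

/-- Codes built from a codebook for the common description and one dictionary per decoder. -/
theorem exists_code_of_dictionaries [Nonempty α] [Nonempty β] {p : α × β → ℝ}
    (hp : ∀ a, 0 ≤ p a) {n : ℕ} {R : Fin 5 → ℝ} (hR : ∀ k, 0 ≤ R k)
    (T : Set ((Fin n → α × β) × (Fin n → υ)))
    (c : Fin (numMessages n (R 0)) → Fin n → υ)
    (D₁ : Fin (numMessages n (R 1)) → Fin n → υ → α)
    (D₂ : Fin (numMessages n (R 2)) → Fin n → υ → β)
    (D₃ : Fin (numMessages n (R 3)) → Fin n → β × υ → α)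
    (D₄ : Fin (numMessages n (R 4)) → Fin n → α × υ → β)
    (h₁ : ∀ z u, (z, u) ∈ T → ∃ m, ∀ i, D₁ m i (u i) = (z i).1)
    (h₂ : ∀ z u, (z, u) ∈ T → ∃ m, ∀ i, D₂ m i (u i) = (z i).2)
    (h₃ : ∀ z u, (z, u) ∈ T → ∃ m, ∀ i, D₃ m i ((z i).2, u i) = (z i).1)
    (h₄ : ∀ z u, (z, u) ∈ T → ∃ m, ∀ i, D₄ m i ((z i).1, u i) = (z i).2) :
    ∃ C : Code α β n R, errorProb p C ≤ prob (iid p n) {z | ∀ m, (z, c m) ∉ T} := by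
  classical
  have henc : ∀ z : Fin n → α × β, ∃ m : (k : Fin 5) → Fin (numMessages n (R k)),
      (∃ m₀, (z, c m₀) ∈ T) →
        (∀ i, D₁ (m 1) i (c (m 0) i) = (z i).1) ∧ (∀ i, D₂ (m 2) i (c (m 0) i) = (z i).2) ∧
        (∀ i, D₃ (m 3) i ((z i).2, c (m 0) i) = (z i).1) ∧
        (∀ i, D₄ (m 4) i ((z i).1, c (m 0) i) = (z i).2) := by
    intro z
    by_cases h : ∃ m₀, (z, c m₀) ∈ T
    · obtain ⟨m₀, hm₀⟩ := h
      obtain ⟨m₁, hm₁⟩ := h₁ _ _ hm₀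
      obtain ⟨m₂, hm₂⟩ := h₂ _ _ hm₀
      obtain ⟨m₃, hm₃⟩ := h₃ _ _ hm₀
      obtain ⟨m₄, hm₄⟩ := h₄ _ _ hm₀
      exact ⟨fun k => match k with | 0 => m₀ | 1 => m₁ | 2 => m₂ | 3 => m₃ | 4 => m₄,
        fun _ => ⟨hm₁, hm₂, hm₃, hm₄⟩⟩
    · exact ⟨fun k => ⟨0, numMessages_pos (hR k)⟩, fun h' => absurd h' h⟩
  choose enc henc using henc
  -- Decoders 3 and 4 use only the present letter of their side information, the entry at `j = i`.
  refine ⟨⟨fun x y => enc fun i => (x i, y i), fun m₀ m i => D₁ m i (c m₀ i),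
    fun m₀ m i => D₂ m i (c m₀ i), fun i m₀ m y => D₃ m i (y ⟨i, Set.mem_Iic.2 le_rfl⟩, c m₀ i),
    fun i m₀ m x => D₄ m i (x ⟨i, Set.mem_Iic.2 le_rfl⟩, c m₀ i)⟩, ?_⟩
  refine prob_mono (iid_nonneg hp n) fun z _ hz m hm => hz ?_
  obtain ⟨e₁, e₂, e₃, e₄⟩ := henc z ⟨m, hm⟩
  exact ⟨funext e₁, funext e₂, e₃, e₄⟩

theorem tendsto_prob_iid_lt_sum {A : Type*} [Fintype A] {q : A → ℝ} (hq : q ∈ stdSimplex ℝ A)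
    {f : A → ℝ} {r : ℝ} (hr : ∑ a, q a * f a < r) :
    Tendsto (fun n => prob (iid q n) {ω | n * r < ∑ i, f (ω i)}) atTop (𝓝 0) := by
  have h := tendsto_prob_iid_sum_nonneg hq (g := fun a => f a - r) (by
    simp only [mul_sub, Finset.sum_sub_distrib, ← Finset.sum_mul, hq.2]
    linarith)
  refine squeeze_zero (fun n => prob_nonneg (iid_nonneg hq.1 n) _) (fun n => ?_) h
  refine prob_mono (iid_nonneg hq.1 n) fun ω _ hω => ?_
  have hω' : n * r < ∑ i, f (ω i) := hω
  simp only [Set.mem_ofPred_eq, Finset.sum_sub_distrib, Finset.sum_const, Finset.card_univ,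
    Fintype.card_fin, nsmul_eq_mul]
  linarith

/-- Eventually a dictionary of rate `r` reproduces all sequences of likelihood at least
`2 ^ (-n r')`, if `r' < r`. -/
theorem eventually_exists_dictionary {S A : Type*} [Fintype S] [Fintype A] [Nonempty S]
    [Nonempty A] {κ : S → A → ℝ} (hκ : ∀ s, κ s ∈ stdSimplex ℝ A) {r r' : ℝ} (hr' : 0 ≤ r')
    (hr : r' < r) :
    ∀ᶠ n : ℕ in atTop, ∃ D : Fin (numMessages n r) → Fin n → S → A,
      ∀ (a : Fin n → A) (s : Fin n → S), (∀ i, 0 < κ (s i) (a i)) →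
        ∑ i, -Real.logb 2 (κ (s i) (a i)) ≤ n * r' → ∃ m, ∀ i, D m i (s i) = a i := by
  have hlim := tendsto_one_sub_pow_numMessages (c := 1)
    (C := ((Fintype.card A * Fintype.card S : ℕ) : ℝ)) one_pos le_rfl hr' hr
    (by exact_mod_cast Nat.mul_pos Fintype.card_pos Fintype.card_pos)
  filter_upwards [hlim.eventually_lt_const one_pos] with n hn
  simp only [one_mul] at hn
  obtain ⟨D, hD⟩ := exists_dictionary hκ (Real.rpow_le_one_of_one_le_of_nonpos (by norm_num) (by
    have : 0 ≤ n * r' := by positivity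
    linarith)) hn
  exact ⟨D, fun a s hpos hsum => hD a s (rpow_neg_le_prod hpos hsum)⟩

variable [Fintype υ]

/-- Achievability from an auxiliary channel `W`, an output law `π` and reconstruction kernels. -/
theorem achievable_of_kernels {p : α × β → ℝ} (hp : p ∈ stdSimplex ℝ (α × β))
    {W : α × β → υ → ℝ} (hW : ∀ z, W z ∈ stdSimplex ℝ υ)
    {π : υ → ℝ} (hπ : π ∈ stdSimplex ℝ υ)
    {κ₁ : υ → α → ℝ} (hκ₁ : ∀ s, κ₁ s ∈ stdSimplex ℝ α)
    {κ₂ : υ → β → ℝ} (hκ₂ : ∀ s, κ₂ s ∈ stdSimplex ℝ β)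
    {κ₃ : β × υ → α → ℝ} (hκ₃ : ∀ s, κ₃ s ∈ stdSimplex ℝ α)
    {κ₄ : α × υ → β → ℝ} (hκ₄ : ∀ s, κ₄ s ∈ stdSimplex ℝ β)
    (hpos : ∀ z u, 0 < p z * W z u → 0 < π u ∧ 0 < κ₁ u z.1 ∧ 0 < κ₂ u z.2 ∧
      0 < κ₃ (z.2, u) z.1 ∧ 0 < κ₄ (z.1, u) z.2)
    {R : Fin 5 → ℝ} (hR : ∀ k, 0 < R k)
    (hR₀ : ∑ x : (α × β) × υ, p x.1 * W x.1 x.2 * -Real.logb 2 (π x.2 / W x.1 x.2) < R 0)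
    (hR₁ : ∑ x : (α × β) × υ, p x.1 * W x.1 x.2 * -Real.logb 2 (κ₁ x.2 x.1.1) < R 1)
    (hR₂ : ∑ x : (α × β) × υ, p x.1 * W x.1 x.2 * -Real.logb 2 (κ₂ x.2 x.1.2) < R 2)
    (hR₃ : ∑ x : (α × β) × υ, p x.1 * W x.1 x.2 * -Real.logb 2 (κ₃ (x.1.2, x.2) x.1.1) < R 3)
    (hR₄ : ∑ x : (α × β) × υ, p x.1 * W x.1 x.2 * -Real.logb 2 (κ₄ (x.1.1, x.2) x.1.2) < R 4) :
    Achievable p R := by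
  classical
  obtain ⟨hα, hβ⟩ := nonempty_prod.1 (nonempty_of_mem_stdSimplex hp)
  have hυ : Nonempty υ := nonempty_of_mem_stdSimplex hπ
  set q : (α × β) × υ → ℝ := fun x => p x.1 * W x.1 x.2 with hqdef
  have hq : q ∈ stdSimplex ℝ ((α × β) × υ) := by
    refine ⟨fun x => mul_nonneg (hp.1 _) ((hW _).1 _), ?_⟩
    rw [Fintype.sum_prod_type]
    simp only [hqdef, ← Finset.mul_sum, (hW _).2, mul_one, hp.2]
  -- The intermediate rates exceed the means, so `T n` is likely, yet stay below `R`, so codebook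
  -- and dictionaries are large enough; the asymptotic lemmas also need them nonnegative.
  obtain ⟨r₀, hr₀, hr₀'⟩ := exists_between (max_lt hR₀ (hR 0))
  obtain ⟨r₁, hr₁, hr₁'⟩ := exists_between (max_lt hR₁ (hR 1))
  obtain ⟨r₂, hr₂, hr₂'⟩ := exists_between (max_lt hR₂ (hR 2))
  obtain ⟨r₃, hr₃, hr₃'⟩ := exists_between (max_lt hR₃ (hR 3))
  obtain ⟨r₄, hr₄, hr₄'⟩ := exists_between (max_lt hR₄ (hR 4))
  rw [max_lt_iff] at hr₀ hr₁ hr₂ hr₃ hr₄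
  let f₀ : (α × β) × υ → ℝ := fun x => -Real.logb 2 (π x.2 / W x.1 x.2)
  let f₁ : (α × β) × υ → ℝ := fun x => -Real.logb 2 (κ₁ x.2 x.1.1)
  let f₂ : (α × β) × υ → ℝ := fun x => -Real.logb 2 (κ₂ x.2 x.1.2)
  let f₃ : (α × β) × υ → ℝ := fun x => -Real.logb 2 (κ₃ (x.1.2, x.2) x.1.1)
  let f₄ : (α × β) × υ → ℝ := fun x => -Real.logb 2 (κ₄ (x.1.1, x.2) x.1.2)
  let T : (n : ℕ) → Set ((Fin n → α × β) × (Fin n → υ)) := fun n =>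
    {zu | (∀ i, 0 < q (zu.1 i, zu.2 i)) ∧ ∑ i, f₀ (zu.1 i, zu.2 i) ≤ n * r₀ ∧
      ∑ i, f₁ (zu.1 i, zu.2 i) ≤ n * r₁ ∧ ∑ i, f₂ (zu.1 i, zu.2 i) ≤ n * r₂ ∧
      ∑ i, f₃ (zu.1 i, zu.2 i) ≤ n * r₃ ∧ ∑ i, f₄ (zu.1 i, zu.2 i) ≤ n * r₄}
  let P : ℕ → ℝ := fun n => prob (iid q n) {ω | ((fun i => (ω i).1), fun i => (ω i).2) ∉ T n}
  have hP : Tendsto P atTop (𝓝 0) := by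
    have hsum := (tendsto_prob_iid_lt_sum hq (f := f₀) hr₀.1).add
      ((tendsto_prob_iid_lt_sum hq (f := f₁) hr₁.1).add
      ((tendsto_prob_iid_lt_sum hq (f := f₂) hr₂.1).add
      ((tendsto_prob_iid_lt_sum hq (f := f₃) hr₃.1).add
      (tendsto_prob_iid_lt_sum hq (f := f₄) hr₄.1))))
    simp only [add_zero] at hsum
    refine squeeze_zero (fun n => prob_nonneg (iid_nonneg hq.1 n) _) (fun n => ?_) hsum
    have h0 := iid_nonneg hq.1 n
    refine le_trans ?_ ((prob_union_le h0 _ _).trans (add_le_add_right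
      ((prob_union_le h0 _ _).trans (add_le_add_right ((prob_union_le h0 _ _).trans
        (add_le_add_right (prob_union_le h0 _ _) _)) _)) _))
    refine prob_mono h0 fun ω hω hT => ?_
    have hω' : ∀ i, 0 < q (ω i) := fun i =>
      (hq.1 _).lt_of_ne' (Finset.prod_ne_zero_iff.1 hω.ne' i (Finset.mem_univ i))
    by_contra hcon
    simp only [Set.mem_union, Set.mem_ofPred_eq, not_or, not_lt] at hcon
    exact hT ⟨hω', hcon.1, hcon.2.1, hcon.2.2.1, hcon.2.2.2.1, hcon.2.2.2.2⟩
  -- Here `θ = 2^{-n r₀} / 2`, the half absorbing the factor `2` in the change-of-measure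
  -- hypothesis. The factor `1 ^ n` only matches the form of the asymptotic lemma.
  let ε : ℕ → ℝ := fun n =>
    (1 - 1 / 2 * (2 : ℝ) ^ (-(n * r₀))) ^ numMessages n (R 0) * 1 ^ n + 2 * P n
  have hε : Tendsto ε atTop (𝓝 0) := by
    have h := (tendsto_one_sub_pow_numMessages (c := 1 / 2) (C := 1) (by norm_num)
      (by norm_num) hr₀.2.le hr₀' one_pos).add (hP.const_mul 2)
    rwa [mul_zero, add_zero] at h
  have hcode : ∀ᶠ n in atTop, ∃ C : Code α β n R, errorProb p C ≤ ε n := by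
    filter_upwards [eventually_exists_dictionary hκ₁ hr₁.2.le hr₁',
      eventually_exists_dictionary hκ₂ hr₂.2.le hr₂',
      eventually_exists_dictionary hκ₃ hr₃.2.le hr₃',
      eventually_exists_dictionary hκ₄ hr₄.2.le hr₄'] with n ⟨D₁, h₁⟩ ⟨D₂, h₂⟩ ⟨D₃, h₃⟩ ⟨D₄, h₄⟩
    have hθ1 : 1 / 2 * (2 : ℝ) ^ (-(n * r₀)) ≤ 1 := by
      have : (2 : ℝ) ^ (-(n * r₀)) ≤ 1 :=
        Real.rpow_le_one_of_one_le_of_nonpos (by norm_num) (by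
          have : 0 ≤ n * r₀ := mul_nonneg (Nat.cast_nonneg n) hr₀.2.le
          linarith)
      linarith
    obtain ⟨c, hc⟩ := exists_typical_covering hp hW hπ (T n) (by positivity) hθ1
      (fun z u hzu => by
        have hWpos : ∀ i, 0 < W (z i) (u i) := fun i =>
          ((hW _).1 _).lt_of_ne' (right_ne_zero_of_mul (hzu.1 i).ne')
        have := rpow_neg_le_prod (f := fun i => π (u i) / W (z i) (u i))
          (fun i => div_pos (hpos _ _ (hzu.1 i)).1 (hWpos i)) hzu.2.1
        rw [Finset.prod_div_distrib, le_div_iff₀ (Finset.prod_pos fun i _ => hWpos i)] at this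
        linarith) (numMessages n (R 0))
    obtain ⟨C, hC⟩ := exists_code_of_dictionaries hp.1 (fun k => (hR k).le) (T n) c D₁ D₂ D₃ D₄
      (fun z u h => h₁ _ _ (fun i => (hpos _ _ (h.1 i)).2.1) h.2.2.1)
      (fun z u h => h₂ _ _ (fun i => (hpos _ _ (h.1 i)).2.2.1) h.2.2.2.1)
      (fun z u h => h₃ _ (fun i => ((z i).2, u i)) (fun i => (hpos _ _ (h.1 i)).2.2.2.1)
        h.2.2.2.2.1)
      (fun z u h => h₄ _ (fun i => ((z i).1, u i)) (fun i => (hpos _ _ (h.1 i)).2.2.2.2)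
        h.2.2.2.2.2)
    refine ⟨C, hC.trans (hc.trans_eq ?_)⟩
    simp only [ε, one_pow, mul_one, P, hqdef]
  -- Achievability asks for a code at every block length; a constant code serves where no code with
  -- error at most `ε n` exists.
  have hexists : ∀ n, ∃ C : Code α β n R,
      (∃ C' : Code α β n R, errorProb p C' ≤ ε n) → errorProb p C ≤ ε n := by
    intro n
    by_cases h : ∃ C' : Code α β n R, errorProb p C' ≤ ε n
    · exact ⟨h.choose, fun _ => h.choose_spec⟩
    · exact ⟨⟨fun _ _ k => ⟨0, numMessages_pos (hR k).le⟩, fun _ _ _ => hα.some,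
        fun _ _ _ => hβ.some, fun _ _ _ _ => hα.some, fun _ _ _ _ => hβ.some⟩,
        fun h' => absurd h' h⟩
  choose C hC using hexists
  exact ⟨C, squeeze_zero' (Eventually.of_forall fun n => prob_nonneg (iid_nonneg hp.1 n) _)
    (hcode.mono fun n h => hC n h) hε⟩

/-- A version of the conditional law of `f` given `g`, defined for all values of `g`. -/
theorem exists_kernel {Ω A S : Type*} [Fintype Ω] [Fintype A] [Fintype S] {q : Ω → ℝ}
    (hq : q ∈ stdSimplex ℝ Ω) (f : Ω → A) (g : Ω → S) :
    ∃ κ : S → A → ℝ, (∀ s, κ s ∈ stdSimplex ℝ A) ∧ (∀ ω, 0 < q ω → 0 < κ (g ω) (f ω)) ∧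
      ∑ ω, q ω * -Real.logb 2 (κ (g ω) (f ω)) = condEntropy q f g := by
  classical
  -- The marginal law of `f` is an arbitrary probability vector used at null values of `g`.
  let κ : S → A → ℝ := fun s => if law q g s = 0 then law q f else condLaw q f g s
  have hκ : ∀ ω, 0 < q ω → κ (g ω) (f ω) = law q (fun ω => (f ω, g ω)) (f ω, g ω) /
      law q g (g ω) := fun ω hω => by
    simp only [κ, if_neg (law_pos hq.1 g hω).ne', condLaw]
  refine ⟨κ, fun s => ?_, fun ω hω => ?_, ?_⟩
  · by_cases h : law q g s = 0
    · simp only [κ, if_pos h]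
      exact ⟨law_nonneg hq.1 f, (sum_law q f).trans hq.2⟩
    · simp only [κ, if_neg h]
      exact condLaw_mem_stdSimplex hq.1 f g h
  · rw [hκ ω hω]
    exact div_pos (law_pos hq.1 (fun ω => (f ω, g ω)) hω) (law_pos hq.1 g hω)
  · rw [condEntropy_eq hq.1, ent, ent, ← Finset.sum_sub_distrib]
    refine Finset.sum_congr rfl fun ω _ => ?_
    rcases (hq.1 ω).eq_or_lt with h0 | h0
    · simp [← h0]
    · rw [hκ ω h0, Real.logb_div (law_pos hq.1 (fun ω => (f ω, g ω)) h0).ne'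
        (law_pos hq.1 g h0).ne']
      ring

theorem condEntropy_nonneg {Ω A S : Type*} [Fintype Ω] [Fintype A] [Fintype S] {q : Ω → ℝ}
    (hq : ∀ ω, 0 ≤ q ω) (f : Ω → A) (g : Ω → S) : 0 ≤ condEntropy q f g := by
  rw [condEntropy_eq hq, sub_nonneg]
  exact ent_mono hq fun ω ω' h => (Prod.mk.inj h).2

theorem mutualInfo_nonneg {Ω A S : Type*} [Fintype Ω] [Fintype A] [Fintype S] {q : Ω → ℝ}
    (hq : q ∈ stdSimplex ℝ Ω) (f : Ω → A) (g : Ω → S) : 0 ≤ mutualInfo q f g := by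
  have h := ent_submodular hq f g fun _ => ()
  rw [ent_congr (f := fun ω => (f ω, g ω, ())) (g := fun ω => (f ω, g ω)) (by simp),
    ent_congr (f := fun ω => (g ω, ())) (g := g) (by simp),
    ent_congr (f := fun ω => (f ω, ())) (g := f) (by simp)] at h
  have h1 : ent q (fun _ => ()) = 0 := by simp [ent, law, prob, hq.2]
  rw [mutualInfo_eq hq.1]
  linarith

/-- Adding `η > 0` to every rate makes the inequalities strict and the rates positive, so that all
message sets are nonempty; the closure absorbs `η → 0`. -/
theorem singleLetterRegion_subset_rateRegion {p : α × β → ℝ} (hp : p ∈ stdSimplex ℝ (α × β)) :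
    singleLetterRegion p ⊆ rateRegion p := by
  classical
  rintro R ⟨k, -, W, hW, h0, h1, h2, h3, h4⟩
  set q := joint p W with hqdef
  have hq : q ∈ stdSimplex ℝ (α × β × Fin k) := by
    refine ⟨fun ω => mul_nonneg (hp.1 _) ((hW _ _).1 _), ?_⟩
    rw [← hp.2]
    simp only [Fintype.sum_prod_type, hqdef, joint, ← Finset.mul_sum, (hW _ _).2, mul_one]
  let X : α × β × Fin k → α := fun ω => ω.1
  let Y : α × β × Fin k → β := fun ω => ω.2.1
  let U : α × β × Fin k → Fin k := fun ω => ω.2.2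
  obtain ⟨κ₁, hκ₁, pos₁, e₁⟩ := exists_kernel hq X U
  obtain ⟨κ₂, hκ₂, pos₂, e₂⟩ := exists_kernel hq Y U
  obtain ⟨κ₃, hκ₃, pos₃, e₃⟩ := exists_kernel hq X fun ω => (Y ω, U ω)
  obtain ⟨κ₄, hκ₄, pos₄, e₄⟩ := exists_kernel hq Y fun ω => (X ω, U ω)
  -- With `π` the law of `U`, the change-of-measure exponent `log (W / π)` equals `log (p W / (p
  -- π))`, whose mean is the mutual information.
  have e₀ : ∑ ω, q ω * -Real.logb 2 (law q U (U ω) / W (X ω) (Y ω) (U ω)) =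
      mutualInfo q (fun ω => (X ω, Y ω)) U := by
    have hZ : ∀ a, law q (fun ω => (X ω, Y ω)) a = p a := by
      intro a
      rw [law_eq_sum_ite]
      simp only [Fintype.sum_prod_type, X, Y, hqdef, joint]
      have : ∀ x y, (∑ u, if (x, y) = a then p (x, y) * W x y u else 0) =
          if (x, y) = a then p (x, y) else 0 := fun x y => by
        split_ifs
        · rw [← Finset.mul_sum, (hW x y).2, mul_one]
        · simp
      simp only [this]
      rw [← Fintype.sum_prod_type' fun x y => if (x, y) = a then p (x, y) else 0]
      simp
    have hZU : ∀ ω, law q (fun ω => ((X ω, Y ω), U ω)) ((X ω, Y ω), U ω) = q ω := by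
      intro ω
      rw [law_eq_sum_ite, Finset.sum_eq_single ω]
      · simp
      · intro ω' _ hne
        refine if_neg fun h => hne ?_
        simp only [Prod.mk.injEq, X, Y, U] at h
        exact Prod.ext h.1.1 (Prod.ext h.1.2 h.2)
      · simp
    rw [mutualInfo_eq hq.1, ent, ent, ent, ← Finset.sum_add_distrib, ← Finset.sum_sub_distrib]
    refine Finset.sum_congr rfl fun ω _ => ?_
    rcases (hq.1 ω).eq_or_lt with hω | hω
    · simp [← hω]
    · have hpW : 0 < p (X ω, Y ω) * W (X ω) (Y ω) (U ω) := hω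
      have hp0 : p (X ω, Y ω) ≠ 0 := left_ne_zero_of_mul hpW.ne'
      have hW0 : W (X ω) (Y ω) (U ω) ≠ 0 := right_ne_zero_of_mul hpW.ne'
      have hqω : q ω = p (X ω, Y ω) * W (X ω) (Y ω) (U ω) := rfl
      rw [hZ, hZU, Real.logb_div (law_pos hq.1 U hω).ne' hW0]
      nth_rw 5 [hqω]
      rw [Real.logb_mul hp0 hW0]
      ring
  have hsum : ∀ F : α × β × Fin k → ℝ, ∑ x : (α × β) × Fin k,
      p x.1 * W x.1.1 x.1.2 x.2 * F (x.1.1, x.1.2, x.2) = ∑ ω, q ω * F ω := fun F => by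
    simp only [Fintype.sum_prod_type, hqdef, joint]
  have hach : ∀ η : ℝ, 0 < η → Achievable p fun k => R k + η := by
    intro η hη
    refine achievable_of_kernels hp (W := fun z => W z.1 z.2) (fun z => hW _ _)
      (π := law q U) ⟨law_nonneg hq.1 U, (sum_law q U).trans hq.2⟩ hκ₁ hκ₂ hκ₃ hκ₄
      (fun z u h => ⟨law_pos hq.1 U (ω := (z.1, z.2, u)) h, pos₁ (z.1, z.2, u) h,
        pos₂ (z.1, z.2, u) h, pos₃ (z.1, z.2, u) h, pos₄ (z.1, z.2, u) h⟩) (fun j => ?_)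
      ((hsum fun ω => -Real.logb 2 (law q U (U ω) / W (X ω) (Y ω) (U ω))).trans_lt ?_)
      ((hsum fun ω => -Real.logb 2 (κ₁ (U ω) (X ω))).trans_lt ?_)
      ((hsum fun ω => -Real.logb 2 (κ₂ (U ω) (Y ω))).trans_lt ?_)
      ((hsum fun ω => -Real.logb 2 (κ₃ (Y ω, U ω) (X ω))).trans_lt ?_)
      ((hsum fun ω => -Real.logb 2 (κ₄ (X ω, U ω) (Y ω))).trans_lt ?_)
    · have n0 := (mutualInfo_nonneg hq (fun ω => (X ω, Y ω)) U).trans h0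
      have n1 := (condEntropy_nonneg hq.1 X U).trans h1
      have n2 := (condEntropy_nonneg hq.1 Y U).trans h2
      have n3 := (condEntropy_nonneg hq.1 X fun ω => (Y ω, U ω)).trans h3
      have n4 := (condEntropy_nonneg hq.1 Y fun ω => (X ω, U ω)).trans h4
      fin_cases j <;> exact add_pos_of_nonneg_of_pos (by assumption) hη
    · rw [e₀]; exact h0.trans_lt (lt_add_of_pos_right _ hη)
    · rw [e₁]; exact h1.trans_lt (lt_add_of_pos_right _ hη)
    · rw [e₂]; exact h2.trans_lt (lt_add_of_pos_right _ hη)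
    · rw [e₃]; exact h3.trans_lt (lt_add_of_pos_right _ hη)
    · rw [e₄]; exact h4.trans_lt (lt_add_of_pos_right _ hη)
  refine mem_closure_of_tendsto (tendsto_add_pi_nhdsGT R)
    (eventually_nhdsWithin_of_forall fun η h => hach η h)

end Achievability

end EGW

theorem theorem1 {α β : Type*} [Fintype α] [Fintype β]
    (p : α × β → ℝ) (hp : p ∈ stdSimplex ℝ (α × β)) :
    EGW.rateRegion p =
      {R : Fin 5 → ℝ |
        ∃ k : ℕ, k ≤ Fintype.card α * Fintype.card β + 2 ∧
        ∃ W : α → β → Fin k → ℝ, (∀ x y, W x y ∈ stdSimplex ℝ (Fin k)) ∧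
          let q : α × β × Fin k → ℝ := EGW.joint p W
          let X : α × β × Fin k → α := fun ω => ω.1
          let Y : α × β × Fin k → β := fun ω => ω.2.1
          let U : α × β × Fin k → Fin k := fun ω => ω.2.2
          EGW.mutualInfo q (fun ω => (X ω, Y ω)) U ≤ R 0 ∧
          EGW.condEntropy q X U ≤ R 1 ∧
          EGW.condEntropy q Y U ≤ R 2 ∧
          EGW.condEntropy q X (fun ω => (Y ω, U ω)) ≤ R 3 ∧
          EGW.condEntropy q Y (fun ω => (X ω, U ω)) ≤ R 4} :=
  Set.Subset.antisymm
    ((EGW.rateRegion_subset_hullRegion hp).trans (EGW.hullRegion_subset_singleLetterRegion hp))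
    (EGW.singleLetterRegion_subset_rateRegion hp)
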